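/- Let $k$ be a field of characteristic zero. For a $k$-vector space (or $k$-algebra) $V$, let $V[[h]]$ denote the $k[[h]]$-module (or $k[[h]]$-algebra) of formal series $\sum_{m\ge 0} v_m h^m$ with $v_m\in V$. Let $U(\mathfrak a)$ be the $k$-algebra generated by $H,X^-,X^+$ subject to the relations $[H,X^{\pm}]=\pm 2X^{\pm}$. The Chevalley generators $H,X^-,X^+$ of $\mathfrak{sl}_2$ (with $[X^+,X^-]=H$) define a canonical surjection $U(\mathfrak a)\to U(\mathfrak{sl}_2)$. A colouring is a family $\psi=(\psi^j(n))_{j\ge 1,\,n\in\mathbb Z}$ of elements of $k[[h]]$ such that (C1) $\psi^j(n)\equiv j(n-j+1) \pmod h$ for all $j\ge 1$ and $n\in\mathbb Z$; (C2) $\psi^{n+1}(n)=0$ for all $n\ge 0$; (C3) $\psi^{n+j+1}(n)=\psi^j(-n-2)$ for all $j\ge 1$ and $n\ge 0$. It is regular if there are functions $g^a:\mathbb Z\to k[[h]]$ ($a\ge 0$) which tend to zero $h$-adically as $a\to\infty$, uniformly (for every $M$, all values of $g^a$ are divisible by $h^M$ once $a$ is large enough), such that $\psi^j(n)=\sum_{a\ge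 0} g^a(j)\,n^a$ for all $j\ge 1$ and $n\in\mathbb Z$. For $n\in\mathbb Z$, let $V_h(n,\psi)$ be the representation of the $k[[h]]$-algebra $U(\mathfrak a)[[h]]$ on $\bigl(\bigoplus_{j\ge 0}k\,b_j\bigr)[[h]]$ given by $$H.b_j=(n-2j)\,b_j,\qquad X^-.b_j=b_{j+1},\qquad X^+.b_0=0,\qquad X^+.b_j=\psi^j(n)\,b_{j-1}\ \ (j\ge 1).$$ Let $U_h(\psi)$ be the quotient of $U(\mathfrak a)[[h]]$ by the two-sided ideal of the elements that act by zero on $V_h(n,\psi)$ for every $n\in\mathbb Z$; the images of $H,X^-,X^+$ in it are denoted by the same letters. Theorem. Let $\psi$ be a regular colouring. There is one and only one $k[[h]]$-algebra isomorphism $g:U(\mathfrak{sl}_2)[[h]]\to U_h(\psi)$ with the following properties: $g(H)=H$, $g(X^-)=X^-$, and the map $g_0:U(\mathfrak{sl}_2)[[h]]/h\,U(\mathfrak{sl}_2)[[h]]\to U_h(\psi)/h\,U_h(\psi)$ induced by $g$ is an isomorphism of $\mathfrak a$-algebras, that is, it is bijective and commutes with the canonical homomorphisms from $U(\mathfrak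 a)$ to both sides. (Such a $g$ is called a $\mathfrak b$-trivialization of $U_h(\psi)$.) -/

import Mathlib

open PowerSeries

noncomputable section

namespace ColouredKM

universe u v w

/-! ### Formal series with coefficients in a vector space or in an algebra -/

/-- For a `k`-vector space `V`, the `k⟦h⟧`-module `V⟦h⟧` of formal series `∑ m, v m • h ^ m`
with coefficients `v m` in `V` (the variable `h` is the power series `X`). -/
structure HSeries (V : Type v) : Type v where
  cf : ℕ → V

namespace HSeries

@[ext] protected theorem ext {V : Type v} {v w : HSeries V} (h : ∀ m, v.cf m = w.cf m) : v = w := by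
  cases v
  cases w
  congr 1
  exact funext h

variable {k : Type u} [Field k]
variable {V : Type v} [AddCommGroup V] [Module k V]
variable {W : Type w} [AddCommGroup W] [Module k W]

instance : AddCommGroup (HSeries V) where
  add v w := ⟨fun m => v.cf m + w.cf m⟩
  zero := ⟨fun _ => 0⟩
  neg v := ⟨fun m => -v.cf m⟩
  sub v w := ⟨fun m => v.cf m - w.cf m⟩
  nsmul c v := ⟨fun m => c • v.cf m⟩
  zsmul c v := ⟨fun m => c • v.cf m⟩
  add_assoc _ _ _ := HSeries.ext fun _ => add_assoc _ _ _
  zero_add _ := HSeries.ext fun _ => zero_add _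
  add_zero _ := HSeries.ext fun _ => add_zero _
  add_comm _ _ := HSeries.ext fun _ => add_comm _ _
  neg_add_cancel _ := HSeries.ext fun _ => neg_add_cancel _
  sub_eq_add_neg _ _ := HSeries.ext fun _ => sub_eq_add_neg _ _
  nsmul_zero _ := HSeries.ext fun _ => zero_nsmul _
  nsmul_succ _ _ := HSeries.ext fun _ => succ_nsmul _ _
  zsmul_zero' _ := HSeries.ext fun _ => zero_zsmul _
  zsmul_succ' c _ := HSeries.ext fun _ => SubNegMonoid.zsmul_succ' c _
  zsmul_neg' c _ := HSeries.ext fun _ => SubNegMonoid.zsmul_neg' c _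

instance : Module k (HSeries V) where
  smul c v := ⟨fun m => c • v.cf m⟩
  one_smul _ := HSeries.ext fun _ => one_smul _ _
  mul_smul _ _ _ := HSeries.ext fun _ => mul_smul _ _ _
  smul_zero _ := HSeries.ext fun _ => smul_zero _
  smul_add _ _ _ := HSeries.ext fun _ => smul_add _ _ _
  add_smul _ _ _ := HSeries.ext fun _ => add_smul _ _ _
  zero_smul _ := HSeries.ext fun _ => zero_smul _ _

@[simp] theorem zero_apply (m : ℕ) : (0 : HSeries V).cf m = 0 := rfl

@[simp] theorem add_apply (v w : HSeries V) (m : ℕ) : (v + w).cf m = v.cf m + w.cf m := rfl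

@[simp] theorem base_smul_apply (c : k) (v : HSeries V) (m : ℕ) : (c • v).cf m = c • v.cf m := rfl

/-- `(∑ c_i h^i) • (∑ v_j h^j) = ∑_m (∑_{i+j=m} c_i • v_j) h^m`. -/
def seriesSMul (c : k⟦X⟧) (v : HSeries V) : HSeries V :=
  ⟨fun m => ∑ p ∈ Finset.HasAntidiagonal.antidiagonal m, PowerSeries.coeff p.1 c • v.cf p.2⟩

theorem seriesSMul_C (c : k) (v : HSeries V) :
    seriesSMul (PowerSeries.C c : k⟦X⟧) v = c • v := by
  ext m
  change ∑ p ∈ Finset.HasAntidiagonal.antidiagonal m,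
    PowerSeries.coeff p.1 (PowerSeries.C c : k⟦X⟧) • v.cf p.2 = c • v.cf m
  rw [Finset.sum_eq_single (0, m)]
  · simp
  · rintro ⟨i, j⟩ hp hne
    have hi : i ≠ 0 := by
      rintro rfl
      apply hne
      simp at hp
      simp [hp]
    simp [PowerSeries.coeff_C, hi]
  · simp

instance : Module k⟦X⟧ (HSeries V) where
  smul := seriesSMul
  one_smul v := by
    change seriesSMul 1 v = v
    rw [← map_one (PowerSeries.C (R := k)), seriesSMul_C, one_smul]
  mul_smul c d v := by
    change seriesSMul (c * d) v = seriesSMul c (seriesSMul d v)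
    ext m
    simp only [seriesSMul, PowerSeries.coeff_mul, Finset.sum_smul, Finset.smul_sum, mul_smul]
    rw [Finset.sum_sigma', Finset.sum_sigma']
    refine Finset.sum_nbij' (fun x => ⟨(x.2.1, x.2.2 + x.1.2), (x.2.2, x.1.2)⟩)
      (fun x => ⟨(x.1.1 + x.2.1, x.2.2), (x.1.1, x.2.1)⟩) ?_ ?_ ?_ ?_ (fun _ _ => rfl) <;>
    · rintro ⟨⟨a, b⟩, ⟨c, d⟩⟩ h
      rw [Finset.mem_sigma, Finset.HasAntidiagonal.mem_antidiagonal,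
        Finset.HasAntidiagonal.mem_antidiagonal] at h
      obtain ⟨h1, h2⟩ := h
      simp only at h1 h2
      subst h2
      subst h1
      simp [add_assoc]
  smul_zero c := by
    change seriesSMul c 0 = 0
    ext m
    simp [seriesSMul]
  smul_add c v w := by
    change seriesSMul c (v + w) = seriesSMul c v + seriesSMul c w
    ext m
    simp [seriesSMul, Finset.sum_add_distrib]
  add_smul c d v := by
    change seriesSMul (c + d) v = seriesSMul c v + seriesSMul d v
    ext m
    simp [seriesSMul, add_smul, Finset.sum_add_distrib]
  zero_smul v := by
    change seriesSMul 0 v = 0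
    ext m
    simp [seriesSMul]

theorem smul_apply (c : k⟦X⟧) (v : HSeries V) (m : ℕ) :
    (c • v).cf m = ∑ p ∈ Finset.HasAntidiagonal.antidiagonal m,
      PowerSeries.coeff p.1 c • v.cf p.2 := rfl

instance : IsScalarTower k k⟦X⟧ (HSeries V) where
  smul_assoc a c v := by
    ext m
    simp [smul_apply, Finset.smul_sum, mul_smul]

instance : SMulCommClass k k⟦X⟧ (HSeries V) where
  smul_comm a c v := by
    ext m
    simp only [smul_apply, Finset.smul_sum, base_smul_apply]
    exact Finset.sum_congr rfl fun p _ => smul_comm _ _ _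

/-- The inclusion `V → V⟦h⟧` as constant series. -/
def const : V →ₗ[k] HSeries V where
  toFun v := ⟨fun m => if m = 0 then v else 0⟩
  map_add' v w := by ext m; by_cases h : m = 0 <;> simp [h]
  map_smul' c v := by ext m; by_cases h : m = 0 <;> simp [h]

theorem const_apply (v : V) (m : ℕ) :
    (const (k := k) v : HSeries V).cf m = if m = 0 then v else 0 := rfl

theorem X_smul_apply_zero (v : HSeries V) : ((X : k⟦X⟧) • v).cf 0 = 0 := by
  simp [smul_apply]

theorem X_smul_apply_succ (v : HSeries V) (m : ℕ) : ((X : k⟦X⟧) • v).cf (m + 1) = v.cf m := by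
  rw [smul_apply, Finset.sum_eq_single (1, m)]
  · simp
  · rintro ⟨i, j⟩ hp hne
    have hi : i ≠ 1 := by
      rintro rfl
      apply hne
      rw [Finset.HasAntidiagonal.mem_antidiagonal] at hp
      simp only [Prod.mk.injEq, true_and]
      omega
    simp [PowerSeries.coeff_X, hi]
  · intro h
    exact absurd (by simp [add_comm]) h

theorem eq_const_add (v : HSeries V) :
    v = const (k := k) (v.cf 0) + (X : k⟦X⟧) • (⟨fun m => v.cf (m + 1)⟩ : HSeries V) := by
  ext m
  cases m with
  | zero => simp [const_apply, X_smul_apply_zero]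
  | succ m => simp [const_apply, X_smul_apply_succ]

/-- A `k⟦h⟧`-linear map out of `V⟦h⟧` into `W⟦h⟧` is determined by its values on `V`. -/
theorem hom_ext {F G : HSeries V →ₗ[k⟦X⟧] HSeries W}
    (h : ∀ v : V, F (const (k := k) v) = G (const (k := k) v)) : F = G := by
  have key : ∀ (m : ℕ) (v : HSeries V), (F v).cf m = (G v).cf m := by
    intro m
    induction m with
    | zero =>
      intro v
      rw [eq_const_add (k := k) v]
      simp [X_smul_apply_zero, h]
    | succ m ih =>
      intro v
      rw [eq_const_add (k := k) v]
      simp only [map_add, map_smul, add_apply, X_smul_apply_succ, h, ih]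
  exact LinearMap.ext fun v => HSeries.ext fun m => key m v

/-- The `k⟦h⟧`-linear extension `V⟦h⟧ → W⟦h⟧` of a `k`-linear map `T : V → W⟦h⟧`:
`∑ v_i h^i ↦ ∑ T(v_i) h^i`. -/
def extend (T : V →ₗ[k] HSeries W) : HSeries V →ₗ[k⟦X⟧] HSeries W where
  toFun v := ⟨fun m => ∑ p ∈ Finset.HasAntidiagonal.antidiagonal m, (T (v.cf p.1)).cf p.2⟩
  map_add' v w := by ext m; simp [Finset.sum_add_distrib]
  map_smul' c v := by
    have hT : ∀ (s : Finset (ℕ × ℕ)) (f : ℕ × ℕ → V) (j : ℕ),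
        (T (∑ q ∈ s, f q)).cf j = ∑ q ∈ s, (T (f q)).cf j := by
      intro s f j
      rw [map_sum]
      exact map_sum (AddMonoidHom.mk' (fun w : HSeries W => w.cf j) fun _ _ => rfl) _ s
    ext m
    simp only [smul_apply, RingHom.id_apply, hT, map_smul, base_smul_apply, Finset.smul_sum]
    rw [Finset.sum_sigma', Finset.sum_sigma']
    refine Finset.sum_nbij' (fun x => ⟨(x.2.1, x.2.2 + x.1.2), (x.2.2, x.1.2)⟩)
      (fun x => ⟨(x.1.1 + x.2.1, x.2.2), (x.1.1, x.2.1)⟩) ?_ ?_ ?_ ?_ (fun _ _ => rfl) <;>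
    · rintro ⟨⟨a, b⟩, ⟨c, d⟩⟩ h
      rw [Finset.mem_sigma, Finset.HasAntidiagonal.mem_antidiagonal,
        Finset.HasAntidiagonal.mem_antidiagonal] at h
      obtain ⟨h1, h2⟩ := h
      simp only at h1 h2
      subst h2
      subst h1
      simp [add_assoc]

theorem extend_apply (T : V →ₗ[k] HSeries W) (v : HSeries V) (m : ℕ) :
    (extend T v).cf m = ∑ p ∈ Finset.HasAntidiagonal.antidiagonal m, (T (v.cf p.1)).cf p.2 := rfl

@[simp] theorem extend_const (T : V →ₗ[k] HSeries W) (v : V) :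
    extend T (const (k := k) v) = T v := by
  ext m
  rw [extend_apply, Finset.sum_eq_single (0, m)]
  · simp [const_apply]
  · rintro ⟨i, j⟩ hp hne
    have hi : i ≠ 0 := by
      rintro rfl
      apply hne
      simp at hp
      simp [hp]
    simp [const_apply, hi]
  · simp

end HSeries

section AlgebraSeries

variable {k : Type u} [Field k] {A : Type v} [Ring A] [Algebra k A]

/-- For a (not necessarily commutative) `k`-algebra `A`, the ring `A⟦h⟧` is a `k⟦h⟧`-algebra
(coefficientwise embedding of `k⟦h⟧`). -/
instance (priority := low) seriesAlgebra : Algebra k⟦X⟧ A⟦X⟧ :=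
  RingHom.toAlgebra' (PowerSeries.map (algebraMap k A)) (by
    intro c x
    ext m
    rw [PowerSeries.coeff_mul, PowerSeries.coeff_mul, ← Finset.Nat.sum_antidiagonal_swap]
    refine Finset.sum_congr rfl fun p _ => ?_
    simp [Algebra.commutes])

theorem seriesAlgebra_smul_coeff (c : k⟦X⟧) (x : A⟦X⟧) (m : ℕ) :
    coeff m (c • x) = ∑ p ∈ Finset.HasAntidiagonal.antidiagonal m, coeff p.1 c • coeff p.2 x := by
  change coeff m (PowerSeries.map (algebraMap k A) c * x) = _
  rw [PowerSeries.coeff_mul]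
  refine Finset.sum_congr rfl fun p _ => ?_
  simp [Algebra.smul_def]

/-- The ring `A⟦h⟧` and the module `A⟦h⟧` have the same underlying `k⟦h⟧`-module. -/
def toHSeries : A⟦X⟧ ≃ₗ[k⟦X⟧] HSeries A where
  toFun x := ⟨fun m => coeff m x⟩
  invFun v := PowerSeries.mk v.cf
  map_add' x y := by ext m; simp
  map_smul' c x := by
    ext m
    simp only [seriesAlgebra_smul_coeff, HSeries.smul_apply, RingHom.id_apply]
  left_inv x := by ext m; simp
  right_inv v := by ext m; simp

theorem toHSeries_C (a : A) :
    toHSeries (k := k) (PowerSeries.C a) = HSeries.const (k := k) a := by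
  ext m
  simp [toHSeries, HSeries.const_apply, PowerSeries.coeff_C]

/-- The `k⟦h⟧`-algebra homomorphism `A⟦h⟧ → B⟦h⟧` induced coefficientwise by `f : A → B`. -/
def seriesMap {B : Type w} [Ring B] [Algebra k B] (f : A →ₐ[k] B) : A⟦X⟧ →ₐ[k⟦X⟧] B⟦X⟧ :=
  { PowerSeries.map (f : A →+* B) with
    commutes' := by
      intro c
      ext m
      change coeff m (PowerSeries.map (f : A →+* B) (PowerSeries.map (algebraMap k A) c)) =
        coeff m (PowerSeries.map (algebraMap k B) c)
      simp }

variable {V : Type w} [AddCommGroup V] [Module k V]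

/-- The linear map underlying `seriesAction`: `(∑ a_i h^i) . v = ∑ (a_i . v) h^i`. -/
def seriesActionAux (ρ : A →ₐ[k] Module.End k⟦X⟧ (HSeries V)) (v : HSeries V) :
    A⟦X⟧ →ₗ[k⟦X⟧] HSeries V :=
  (HSeries.extend
    ({ toFun := fun a => ρ a v
       map_add' := by intro a b; simp
       map_smul' := by intro c a; simp } : A →ₗ[k] HSeries V)).comp
    (toHSeries (k := k) (A := A)).toLinearMap

theorem seriesActionAux_C (ρ : A →ₐ[k] Module.End k⟦X⟧ (HSeries V)) (v : HSeries V) (a : A) :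
    seriesActionAux ρ v (PowerSeries.C a) = ρ a v := by
  simp [seriesActionAux, toHSeries_C]

theorem series_hom_ext {F G : A⟦X⟧ →ₗ[k⟦X⟧] HSeries V}
    (h : ∀ a : A, F (PowerSeries.C a) = G (PowerSeries.C a)) : F = G := by
  have h' : F.comp (toHSeries (k := k) (A := A)).symm.toLinearMap =
      G.comp (toHSeries (k := k) (A := A)).symm.toLinearMap := by
    apply HSeries.hom_ext
    intro a
    simp only [← toHSeries_C, LinearMap.comp_apply, LinearEquiv.coe_coe,
      LinearEquiv.symm_apply_apply, h]
  ext1 x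
  simpa using LinearMap.congr_fun h' (toHSeries (k := k) x)

theorem seriesActionAux_C_mul (ρ : A →ₐ[k] Module.End k⟦X⟧ (HSeries V)) (v : HSeries V)
    (a : A) (y : A⟦X⟧) :
    seriesActionAux ρ v (PowerSeries.C a * y) = ρ a (seriesActionAux ρ v y) := by
  have h : (seriesActionAux ρ v).comp (LinearMap.mulLeft k⟦X⟧ (PowerSeries.C a : A⟦X⟧)) =
      (ρ a).comp (seriesActionAux ρ v) := by
    apply series_hom_ext
    intro b
    simp only [LinearMap.comp_apply, LinearMap.mulLeft_apply, ← map_mul, seriesActionAux_C]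
    simp
  exact LinearMap.congr_fun h y

theorem seriesActionAux_mul (ρ : A →ₐ[k] Module.End k⟦X⟧ (HSeries V)) (v : HSeries V)
    (x y : A⟦X⟧) :
    seriesActionAux ρ v (x * y) = seriesActionAux ρ (seriesActionAux ρ v y) x := by
  have h : (seriesActionAux ρ v).comp (LinearMap.mulRight k⟦X⟧ y) =
      seriesActionAux ρ (seriesActionAux ρ v y) := by
    apply series_hom_ext
    intro a
    simp only [LinearMap.comp_apply, LinearMap.mulRight_apply, seriesActionAux_C_mul,
      seriesActionAux_C]
  exact LinearMap.congr_fun h x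

/-- A representation of the `k`-algebra `A` on `V⟦h⟧` by `k⟦h⟧`-linear maps extends to a
representation of the `k⟦h⟧`-algebra `A⟦h⟧`, by `(∑ a_i h^i) . v = ∑ (a_i . v) h^i`. -/
def seriesAction (ρ : A →ₐ[k] Module.End k⟦X⟧ (HSeries V)) :
    A⟦X⟧ →ₐ[k⟦X⟧] Module.End k⟦X⟧ (HSeries V) :=
  AlgHom.ofLinearMap
    ({ toFun := fun x =>
        { toFun := fun v => seriesActionAux ρ v x
          map_add' := by
            intro v w
            have h : seriesActionAux ρ (v + w) = seriesActionAux ρ v + seriesActionAux ρ w := by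
              apply series_hom_ext
              intro a
              simp [seriesActionAux_C]
            rw [h, LinearMap.add_apply]
          map_smul' := by
            intro c v
            have h : seriesActionAux ρ (c • v) = c • seriesActionAux ρ v := by
              apply series_hom_ext
              intro a
              simp [seriesActionAux_C]
            rw [h, LinearMap.smul_apply, RingHom.id_apply] }
       map_add' := by intro x y; ext1 v; simp
       map_smul' := by intro c x; ext1 v; simp } :
      A⟦X⟧ →ₗ[k⟦X⟧] Module.End k⟦X⟧ (HSeries V))
    (by
      ext1 v
      have h := seriesActionAux_C ρ v 1
      simpa using h)
    (by
      intro x y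
      ext1 v
      exact seriesActionAux_mul ρ v x y)

@[simp] theorem seriesAction_C (ρ : A →ₐ[k] Module.End k⟦X⟧ (HSeries V)) (a : A) :
    seriesAction ρ (PowerSeries.C a) = ρ a := by
  ext1 v
  exact seriesActionAux_C ρ v a

end AlgebraSeries

/-! ### Reduction modulo `h` -/

section Reduction

variable (k : Type u) [Field k]
variable (A : Type v) [Ring A] [Algebra k⟦X⟧ A]

/-- The two-sided ideal `hA` of a `k⟦h⟧`-algebra `A`. -/
def hIdeal : Ideal A where
  carrier := {a | ∃ b : A, a = (X : k⟦X⟧) • b}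
  add_mem' := by
    rintro _ _ ⟨b, rfl⟩ ⟨c, rfl⟩
    exact ⟨b + c, (smul_add _ _ _).symm⟩
  zero_mem' := ⟨0, (smul_zero _).symm⟩
  smul_mem' := by
    rintro c _ ⟨b, rfl⟩
    exact ⟨c * b, by simp⟩

instance : (hIdeal k A).IsTwoSided where
  mul_mem_of_left := by
    rintro _ c ⟨b, rfl⟩
    exact ⟨b * c, by simp⟩

/-- The reduction `A₀ = A / hA`. -/
abbrev HZero : Type v := A ⧸ hIdeal k A

variable {k A}
variable {B : Type w} [Ring B] [Algebra k⟦X⟧ B]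

/-- The homomorphism `g₀ : A / hA → B / hB` induced by `g : A → B`. -/
def hzeroMap (g : A →ₐ[k⟦X⟧] B) : HZero k A →ₐ[k⟦X⟧] HZero k B :=
  Ideal.quotientMapₐ (hIdeal k B) g (by
    rintro _ ⟨b, rfl⟩
    exact ⟨g b, by simp⟩)

end Reduction

variable (k : Type u) [Field k]

/-! ### The algebra `U(𝔞)` of the non-deformed relations, and `U(𝔰𝔩₂)` -/

/-- The Chevalley generators. -/
inductive Gen : Type
  | H : Gen
  | Xm : Gen
  | Xp : Gen

/-- The non-deformed relations `[H, X⁺] = 2 X⁺` and `[H, X⁻] = -2 X⁻`. -/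
inductive UaRel : FreeAlgebra k Gen → FreeAlgebra k Gen → Prop
  | xp : UaRel
      (FreeAlgebra.ι k Gen.H * FreeAlgebra.ι k Gen.Xp -
        FreeAlgebra.ι k Gen.Xp * FreeAlgebra.ι k Gen.H)
      ((2 : k) • FreeAlgebra.ι k Gen.Xp)
  | xm : UaRel
      (FreeAlgebra.ι k Gen.H * FreeAlgebra.ι k Gen.Xm -
        FreeAlgebra.ι k Gen.Xm * FreeAlgebra.ι k Gen.H)
      ((-2 : k) • FreeAlgebra.ι k Gen.Xm)

/-- `U(𝔞)`: the `k`-algebra generated by `H, X⁻, X⁺` subject to the non-deformed relations. -/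
abbrev Ua : Type u := RingQuot (UaRel k)

/-- The generators of `U(𝔞)`. -/
def Ua.gen (x : Gen) : Ua k := RingQuot.mkAlgHom k (UaRel k) (FreeAlgebra.ι k x)

/-- The algebra homomorphism out of `U(𝔞)` with prescribed values on the generators. -/
def Ua.lift {B : Type v} [Ring B] [Algebra k B] (f : Gen → B)
    (hp : f Gen.H * f Gen.Xp - f Gen.Xp * f Gen.H = (2 : k) • f Gen.Xp)
    (hm : f Gen.H * f Gen.Xm - f Gen.Xm * f Gen.H = (-2 : k) • f Gen.Xm) : Ua k →ₐ[k] B :=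
  RingQuot.liftAlgHom k ⟨FreeAlgebra.lift k f, by
    intro x y h
    cases h with
    | xp => simpa using hp
    | xm => simpa using hm⟩

@[simp] theorem Ua.lift_gen {B : Type v} [Ring B] [Algebra k B] (f : Gen → B)
    (hp : f Gen.H * f Gen.Xp - f Gen.Xp * f Gen.H = (2 : k) • f Gen.Xp)
    (hm : f Gen.H * f Gen.Xm - f Gen.Xm * f Gen.H = (-2 : k) • f Gen.Xm) (x : Gen) :
    Ua.lift k f hp hm (Ua.gen k x) = f x := by
  simp [Ua.lift, Ua.gen]

/-- The Lie algebra `𝔰𝔩₂` of traceless `2 × 2` matrices. -/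
abbrev Sl2 : Type u := LieAlgebra.SpecialLinear.sl (Fin 2) k

/-- The enveloping algebra `U(𝔰𝔩₂)`. -/
abbrev USl2 : Type u := UniversalEnvelopingAlgebra k (Sl2 k)

/-- The Chevalley generators of `𝔰𝔩₂`: `H = diag(1, -1)`, `X⁻ = E₂₁`, `X⁺ = E₁₂`. -/
def sl2Gen : Gen → Sl2 k
  | Gen.H => LieAlgebra.SpecialLinear.singleSubSingle 0 1 (1 : k)
  | Gen.Xm => LieAlgebra.SpecialLinear.single 1 0 (by decide) (1 : k)
  | Gen.Xp => LieAlgebra.SpecialLinear.single 0 1 (by decide) (1 : k)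

/-- The Chevalley generators in `U(𝔰𝔩₂)`. -/
def USl2.gen (x : Gen) : USl2 k := UniversalEnvelopingAlgebra.ι k (sl2Gen k x)

theorem USl2.rel_of_lie (x y : Gen) (c : k) (h : ⁅sl2Gen k x, sl2Gen k y⁆ = c • sl2Gen k y) :
    USl2.gen k x * USl2.gen k y - USl2.gen k y * USl2.gen k x = c • USl2.gen k y := by
  let _ : LieRing (USl2 k) := LieRing.ofAssociativeRing
  have h' := (UniversalEnvelopingAlgebra.ι k).map_lie (sl2Gen k x) (sl2Gen k y)
  rw [h, map_smul, LieRing.of_associative_ring_bracket] at h'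
  exact h'.symm

theorem sl2Gen_lie_H_Xp :
    ⁅sl2Gen k Gen.H, sl2Gen k Gen.Xp⁆ = (2 : k) • sl2Gen k Gen.Xp := by
  apply Subtype.ext
  ext i j
  fin_cases i <;> fin_cases j <;>
    simp [sl2Gen, LieRing.of_associative_ring_bracket, Matrix.mul_apply, Matrix.single_apply]
  norm_num

theorem sl2Gen_lie_H_Xm :
    ⁅sl2Gen k Gen.H, sl2Gen k Gen.Xm⁆ = (-2 : k) • sl2Gen k Gen.Xm := by
  apply Subtype.ext
  ext i j
  fin_cases i <;> fin_cases j <;>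
    simp [sl2Gen, LieRing.of_associative_ring_bracket, Matrix.mul_apply, Matrix.single_apply]
  norm_num

/-- The canonical homomorphism `U(𝔞) → U(𝔰𝔩₂)`: the `𝔞`-algebra structure of `U(𝔰𝔩₂)`. -/
def UaToUSl2 : Ua k →ₐ[k] USl2 k :=
  Ua.lift k (USl2.gen k)
    (USl2.rel_of_lie k _ _ _ (sl2Gen_lie_H_Xp k))
    (USl2.rel_of_lie k _ _ _ (sl2Gen_lie_H_Xm k))

/-! ### Colourings -/

/-- A colouring: power series `ψ^j(n)` for `j ≥ 1` and `n ∈ ℤ` subject to (C1), (C2), (C3).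
(The entries `toFun 0 n` are irrelevant.) -/
structure Colouring where
  toFun : ℕ → ℤ → k⟦X⟧
  c1 : ∀ (j : ℕ) (n : ℤ), 1 ≤ j → constantCoeff (toFun j n) = (j : k) * ((n : k) - (j : k) + 1)
  c2 : ∀ n : ℕ, toFun (n + 1) (n : ℤ) = 0
  c3 : ∀ j n : ℕ, 1 ≤ j → toFun (n + j + 1) (n : ℤ) = toFun j (-(n : ℤ) - 2)

variable {k}

/-- A colouring `ψ` is regular if there is a sequence `(g^a)_{a ≥ 0}` of functions `ℤ → k⟦h⟧`
tending to zero for the `h`-adic topology (uniformly), such that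
`ψ^j(n) = ∑_a g^a(j) n^a` (an `h`-adically convergent series) for all `j ≥ 1` and all `n`. -/
def Colouring.IsRegular (ψ : Colouring k) : Prop :=
  ∃ g : ℕ → ℤ → k⟦X⟧,
    (∀ M : ℕ, ∃ N : ℕ, ∀ a, N ≤ a → ∀ j : ℤ, (X : k⟦X⟧) ^ M ∣ g a j) ∧
    ∀ (j : ℕ) (n : ℤ), 1 ≤ j → ∀ M : ℕ, ∃ N : ℕ, ∀ N', N ≤ N' →
      (X : k⟦X⟧) ^ M ∣ ψ.toFun j n - ∑ a ∈ Finset.range N', g a (j : ℤ) * (n : k⟦X⟧) ^ a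

/-! ### Deformed Verma modules -/

variable (k) in
/-- The underlying `k⟦h⟧`-module `(⨁_{j ≥ 0} k b_j)⟦h⟧` of the deformed Verma modules. -/
abbrev VermaSpace : Type u := HSeries (ℕ →₀ k)

variable (k) in
/-- The vector `b_j`. -/
def b (j : ℕ) : VermaSpace k := HSeries.const (k := k) (Finsupp.single j (1 : k))

/-- The `k⟦h⟧`-linear endomorphism of `(⨁ k b_j)⟦h⟧` with `b_j ↦ f j`. -/
def opOfBasis (f : ℕ → VermaSpace k) : Module.End k⟦X⟧ (VermaSpace k) :=
  HSeries.extend (Finsupp.linearCombination k f)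

@[simp] theorem opOfBasis_b (f : ℕ → VermaSpace k) (j : ℕ) : opOfBasis f (b k j) = f j := by
  simp [opOfBasis, b]

theorem op_ext {F G : Module.End k⟦X⟧ (VermaSpace k)} (h : ∀ j, F (b k j) = G (b k j)) :
    F = G := by
  apply HSeries.hom_ext
  intro v
  have h' : (F.restrictScalars k).comp (HSeries.const (k := k)) =
      (G.restrictScalars k).comp (HSeries.const (k := k) (V := ℕ →₀ k)) := by
    apply Finsupp.lhom_ext'
    intro j
    apply LinearMap.ext_ring
    exact h j
  exact LinearMap.congr_fun h' v

/-- The action of the generators on the deformed Verma module of highest weight `n`: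
`H.b_j = (n - 2j) b_j`, `X⁻.b_j = b_{j+1}`, `X⁺.b_0 = 0`, `X⁺.b_j = ψ^j(n) b_{j-1}` (`j ≥ 1`). -/
def vermaOp (ψ : Colouring k) (n : ℤ) : Gen → Module.End k⟦X⟧ (VermaSpace k)
  | Gen.H => opOfBasis fun j => ((n : k) - 2 * (j : k)) • b k j
  | Gen.Xm => opOfBasis fun j => b k (j + 1)
  | Gen.Xp => opOfBasis fun j => if j = 0 then 0 else ψ.toFun j n • b k (j - 1)

theorem vermaOp_rel_xp (ψ : Colouring k) (n : ℤ) :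
    vermaOp ψ n Gen.H * vermaOp ψ n Gen.Xp - vermaOp ψ n Gen.Xp * vermaOp ψ n Gen.H =
      (2 : k) • vermaOp ψ n Gen.Xp := by
  apply op_ext
  intro j
  cases j with
  | zero => simp [vermaOp, LinearMap.map_smul_of_tower]
  | succ j =>
    simp only [vermaOp, LinearMap.sub_apply, Module.End.mul_apply, opOfBasis_b,
      LinearMap.smul_apply, LinearMap.map_smul_of_tower, map_smul, Nat.succ_ne_zero, if_false,
      Nat.add_sub_cancel]
    rw [smul_comm ((n : k) - 2 * ((j + 1 : ℕ) : k)) (ψ.toFun (j + 1) n),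
      smul_comm (2 : k) (ψ.toFun (j + 1) n), ← smul_sub, ← sub_smul]
    congr 2
    push_cast
    ring

theorem vermaOp_rel_xm (ψ : Colouring k) (n : ℤ) :
    vermaOp ψ n Gen.H * vermaOp ψ n Gen.Xm - vermaOp ψ n Gen.Xm * vermaOp ψ n Gen.H =
      (-2 : k) • vermaOp ψ n Gen.Xm := by
  apply op_ext
  intro j
  simp only [vermaOp, LinearMap.sub_apply, Module.End.mul_apply, opOfBasis_b,
    LinearMap.smul_apply, LinearMap.map_smul_of_tower]
  rw [← sub_smul]
  congr 1
  push_cast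
  ring

/-- The deformed Verma module of highest weight `n`, as a representation of `U(𝔞)`. -/
def vermaRep (ψ : Colouring k) (n : ℤ) : Ua k →ₐ[k] Module.End k⟦X⟧ (VermaSpace k) :=
  Ua.lift k (vermaOp ψ n) (vermaOp_rel_xp ψ n) (vermaOp_rel_xm ψ n)

/-- The deformed Verma module of highest weight `n`, as a representation of `U(𝔞)⟦h⟧`. -/
def vermaRepH (ψ : Colouring k) (n : ℤ) :
    (Ua k)⟦X⟧ →ₐ[k⟦X⟧] Module.End k⟦X⟧ (VermaSpace k) :=
  seriesAction (vermaRep ψ n)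

/-! ### The coloured algebra `U_h(ψ)` -/

/-- The two-sided ideal of `U(𝔞)⟦h⟧` of the elements that act by zero on all the deformed Verma
modules. -/
def vermaIdeal (ψ : Colouring k) : Ideal (Ua k)⟦X⟧ where
  carrier := {x | ∀ (n : ℤ) (v : VermaSpace k), vermaRepH ψ n x v = 0}
  add_mem' := by
    intro x y hx hy n v
    rw [map_add, LinearMap.add_apply, hx, hy, add_zero]
  zero_mem' := by
    intro n v
    rw [map_zero, LinearMap.zero_apply]
  smul_mem' := by
    intro c x hx n v
    rw [smul_eq_mul, map_mul, Module.End.mul_apply, hx, map_zero]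

instance (ψ : Colouring k) : (vermaIdeal ψ).IsTwoSided where
  mul_mem_of_left := by
    intro x c hx n v
    rw [map_mul, Module.End.mul_apply]
    exact hx n _

/-- `U_h(ψ)`: the quotient of `U(𝔞)⟦h⟧` by the ideal of the elements acting by zero on all the
deformed Verma modules. -/
abbrev Uh (ψ : Colouring k) : Type u := (Ua k)⟦X⟧ ⧸ vermaIdeal ψ

/-- The projection `U(𝔞)⟦h⟧ → U_h(ψ)`. -/
def Uh.proj (ψ : Colouring k) : (Ua k)⟦X⟧ →ₐ[k⟦X⟧] Uh ψ :=
  Ideal.Quotient.mkₐ k⟦X⟧ (vermaIdeal ψ)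

/-- The generators `H, X⁻, X⁺` of `U_h(ψ)`. -/
def Uh.gen (ψ : Colouring k) (x : Gen) : Uh ψ := Uh.proj ψ (PowerSeries.C (Ua.gen k x))

/-! ### `𝔟`-trivializations -/

/-- The `𝔞`-algebra structure `U(𝔞) → A / hA` on the reduction of a `U(𝔞)⟦h⟧`-algebra `A` with
structural homomorphism `f`. -/
def hzeroStr {A : Type v} [Ring A] [Algebra k⟦X⟧ A] (f : (Ua k)⟦X⟧ →ₐ[k⟦X⟧] A) :
    Ua k →+* HZero k A :=
  ((Ideal.Quotient.mk (hIdeal k A)).comp (f : (Ua k)⟦X⟧ →+* A)).comp PowerSeries.C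

/-- A `𝔟`-trivialization of `U_h(ψ)`: a `k⟦h⟧`-algebra isomorphism `g : U(𝔰𝔩₂)⟦h⟧ → U_h(ψ)` with
`g(H) = H`, `g(X⁻) = X⁻`, whose reduction modulo `h` is an isomorphism of `𝔞`-algebras. -/
structure IsBTrivialization (ψ : Colouring k) (g : (USl2 k)⟦X⟧ ≃ₐ[k⟦X⟧] Uh ψ) : Prop where
  map_H : g (PowerSeries.C (USl2.gen k Gen.H)) = Uh.gen ψ Gen.H
  map_Xm : g (PowerSeries.C (USl2.gen k Gen.Xm)) = Uh.gen ψ Gen.Xm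
  hzero_bijective : Function.Bijective (hzeroMap (g : (USl2 k)⟦X⟧ →ₐ[k⟦X⟧] Uh ψ))
  hzero_str : ∀ x : Ua k,
    hzeroMap (g : (USl2 k)⟦X⟧ →ₐ[k⟦X⟧] Uh ψ) (hzeroStr (seriesMap (UaToUSl2 k)) x) =
      hzeroStr (Uh.proj ψ) x

end ColouredKM

end

noncomputable section

namespace ColouredKM

-- Both algebras act on the spaces of the Verma modules of all integral highest weights `n`.
-- `U_h(ψ)` acts faithfully by definition, and `U(𝔰𝔩₂)⟦h⟧` acts faithfully through the undeformed
-- Verma modules. The isomorphism is obtained by showing that both have the same image in `∏ₙ End((⨁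
-- k b_j)⟦h⟧)` (`range_stdAct`).
--
-- `H` and `X⁻` act in the same way on both sides, so the point is to express the classical operator
-- `b_j ↦ j(n-j+1) b_{j-1}` through `U_h(ψ)`. In the variables `a = j`, `b = j-n-1`, condition (C3)
-- says that `F^j(n)` is symmetric in `a` and `b`, and regularity makes every coefficient of `h^m`
-- polynomial in `b`, of degree bounded in `a`. Such a function is a polynomial in `a+b` and `ab`
-- (`exists_evalEval_of_symm`). Here `a+b` is the eigenvalue of `-H-1` on `b_j`, and `ab =
-- -j(n-j+1)` is, modulo `h`, that of `-X⁻X⁺`. Condition (C2) says that the function vanishes at `b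
-- = 0`, so `ab` can be split off (`exists_constantCoeff_eq`). Hence every operator `b_j ↦ F^j(n)
-- b_{j-1}` of this kind agrees modulo `h` with `X⁺` times a polynomial in `H` and `X⁻X⁺`. The error
-- is `h` times an operator of the same kind, and successive approximation realizes `F` exactly
-- (`exists_vermaRepH_eq_lower`). Applied to `h⁻¹` times the difference of the classical colouring
-- and `ψ`, this writes the classical operator as `X⁺ + h z`. One inclusion of images follows, the
-- other by a further approximation, and so does the compatibility modulo `h`.
--
-- For uniqueness, the `𝔰𝔩₂`-relations leave no choice for the operator of `X⁺` once `H` and `X⁻`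
-- act in the standard way: `X⁺ b_0` would have weight `n+2`, which does not occur, and `[X⁺, X⁻] =
-- H` determines the rest (`eq_stdOp_Xp`).

universe u v w

/-! ### Symmetric functions of two positive integers -/

open Polynomial in
/-- A symmetric function on pairs of positive integers which is polynomial of bounded degree in one
variable is a polynomial in the sum and the product of the variables. -/
theorem exists_evalEval_of_symm {k : Type u} [Field k] [CharZero k] (D : ℕ) :
    ∀ f : ℕ → k[X], (∀ a, 1 ≤ a → (f a).natDegree < D ∨ f a = 0) →
      (∀ a b : ℕ, 1 ≤ a → 1 ≤ b → (f a).eval (b : k) = (f b).eval (a : k)) →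
      ∃ q : k[X][X], ∀ a : ℕ, 1 ≤ a → ∀ x : k,
        (f a).eval x = q.evalEval ((a : k) + x) ((a : k) * x) := by
  induction D with
  | zero =>
    intro f hf _
    refine ⟨0, fun a ha x => ?_⟩
    have h : f a = 0 := by simpa using hf a ha
    simp [h]
  | succ D ih =>
    intro f hf hs
    have hdeg : ∀ a, 1 ≤ a → (f a).natDegree ≤ D := by
      intro a ha
      rcases hf a ha with h | h
      · omega
      · simp [h]
    have hinj : Set.InjOn (fun i : ℕ => ((i + 1 : ℕ) : k)) (Finset.range (D + 1)) := by
      intro i _ j _ h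
      have := Nat.cast_injective (R := k) h
      omega
    obtain ⟨r, hrD, hr⟩ : ∃ r : k[X], r.natDegree ≤ D ∧
        ∀ a : ℕ, 1 ≤ a → r.eval (a : k) = (f a).eval 0 := by
      -- Lagrange interpolation at the nodes `1, …, D+1` gives `f_a(0) = ∑ L_i(0) f_a(i+1)`, and by
      -- symmetry `f_a(i+1) = f_{i+1}(a)`. So `a ↦ f_a(0)` is itself a polynomial.
      refine ⟨∑ i ∈ Finset.range (D + 1), Polynomial.C ((Lagrange.basis (Finset.range (D + 1))
        (fun i : ℕ => ((i + 1 : ℕ) : k)) i).eval 0) * f (i + 1), ?_, ?_⟩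
      · refine natDegree_sum_le_of_forall_le _ _ fun i _ => ?_
        exact (natDegree_C_mul_le _ _).trans (hdeg _ (by omega))
      · intro a ha
        have hlt : (f a).degree < (Finset.range (D + 1)).card := by
          rw [Finset.card_range]
          exact lt_of_le_of_lt degree_le_natDegree
            (by exact_mod_cast Nat.lt_succ_of_le (hdeg a ha))
        conv_rhs => rw [Lagrange.eq_interpolate hinj hlt, Lagrange.interpolate_apply]
        rw [eval_finsetSum, eval_finsetSum]
        refine Finset.sum_congr rfl fun i _ => ?_
        rw [eval_mul, eval_mul, eval_C, eval_C, hs a (i + 1) ha (by omega), mul_comm]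
    -- Subtracting the symmetric function `r(a+x)` preserves symmetry and makes the difference
    -- vanish at `x = 0`, hence divisible by `x`.
    let p : ℕ → k[X] := fun a => f a - r.comp (Polynomial.C (a : k) + Polynomial.X)
    have hp0 : ∀ a, 1 ≤ a → (p a).coeff 0 = 0 := by
      intro a ha
      simp [p, coeff_zero_eq_eval_zero, eval_comp, hr a ha]
    have hpD : ∀ a, 1 ≤ a → (p a).natDegree ≤ D := by
      intro a ha
      refine (natDegree_sub_le _ _).trans (max_le (hdeg a ha) (natDegree_comp_le.trans ?_))
      have : (Polynomial.C (a : k) + Polynomial.X).natDegree ≤ 1 := by compute_degree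
      nlinarith
    have hfx : ∀ a : ℕ, 1 ≤ a → ∀ x : k,
        (f a).eval x = r.eval ((a : k) + x) + x * (p a).divX.eval x := by
      intro a ha x
      have h := congrArg (eval x) (divX_mul_X_add (p a))
      rw [hp0 a ha] at h
      simp only [p, map_zero, add_zero, eval_mul, eval_X, eval_sub, eval_comp, eval_add,
        eval_C] at h ⊢
      linear_combination -h
    have hne : ∀ a : ℕ, 1 ≤ a → (a : k) ≠ 0 := fun a ha => Nat.cast_ne_zero.2 (by omega)
    -- Division by `x` alone would break the symmetry; division by `a x` keeps it and lowers the
    -- degree in `x` by one.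
    obtain ⟨q, hq⟩ := ih (fun a => Polynomial.C (a : k)⁻¹ * (p a).divX) (by
        intro a ha
        rcases Nat.eq_zero_or_pos D with h0 | h0
        · right
          -- For `D = 0` the quotient has no smaller `natDegree`, but `p a` is a constant without
          -- constant term.
          have hpa : p a = 0 := by
            have h1 := eq_C_of_natDegree_le_zero (h0 ▸ hpD a ha)
            rw [h1, hp0 a ha, map_zero]
          simp [hpa]
        · left
          refine lt_of_le_of_lt (natDegree_C_mul_le _ _) ?_
          rw [natDegree_divX_eq_natDegree_tsub_one]
          have := hpD a ha
          omega) (by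
        intro a b ha hb
        have h := hs a b ha hb
        rw [hfx a ha, hfx b hb, add_comm (b : k) (a : k)] at h
        simp only [eval_mul, eval_C]
        have h1 := hne a ha
        have h2 := hne b hb
        field_simp
        linear_combination h)
    refine ⟨Polynomial.C r + Polynomial.X * q, fun a ha x => ?_⟩
    have h := hq a ha x
    simp only [eval_mul, eval_C] at h
    rw [hfx a ha, evalEval_add, evalEval_mul, evalEval_C, evalEval_X, ← h]
    have h1 := hne a ha
    field_simp

/-! ### Regular symmetric functions of `j` and `n` -/

variable {k : Type u} [Field k]

variable (k) in
/-- The functions `F^j(n)` which are, modulo every power of `h`, polynomial in `n` of degree bounded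
uniformly in `j`, and which satisfy the symmetry (C3). -/
def regularSymmetric : Subalgebra k (ℕ → ℤ → k⟦X⟧) where
  carrier := {F | (∀ m, ∃ D, ∀ j, 1 ≤ j → ∃ p : Polynomial k, p.natDegree ≤ D ∧
      ∀ n : ℤ, coeff m (F j n) = p.eval (n : k)) ∧
    ∀ j n : ℕ, 1 ≤ j → F (n + j + 1) n = F j (-(n : ℤ) - 2)}
  mul_mem' := by
    rintro F G ⟨hF, hF'⟩ ⟨hG, hG'⟩
    refine ⟨fun m => ?_, fun j n hj => by simp [hF' j n hj, hG' j n hj]⟩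
    choose D hD using hF
    choose E hE using hG
    refine ⟨(Finset.HasAntidiagonal.antidiagonal m).sup fun p => D p.1 + E p.2, fun j hj => ?_⟩
    choose P hP using fun m => hD m j hj
    choose Q hQ using fun m => hE m j hj
    refine ⟨∑ p ∈ Finset.HasAntidiagonal.antidiagonal m, P p.1 * Q p.2, ?_, fun n => ?_⟩
    · refine Polynomial.natDegree_sum_le_of_forall_le _ _ fun p hp => ?_
      refine Polynomial.natDegree_mul_le.trans ((add_le_add (hP p.1).1 (hQ p.2).1).trans ?_)
      exact Finset.le_sup (f := fun p : ℕ × ℕ => D p.1 + E p.2) hp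
    · simp [PowerSeries.coeff_mul, Polynomial.eval_finsetSum, (hP _).2, (hQ _).2]
  add_mem' := by
    rintro F G ⟨hF, hF'⟩ ⟨hG, hG'⟩
    refine ⟨fun m => ?_, fun j n hj => by simp [hF' j n hj, hG' j n hj]⟩
    obtain ⟨D, hD⟩ := hF m
    obtain ⟨E, hE⟩ := hG m
    refine ⟨max D E, fun j hj => ?_⟩
    obtain ⟨P, hP, hP'⟩ := hD j hj
    obtain ⟨Q, hQ, hQ'⟩ := hE j hj
    exact ⟨P + Q, (Polynomial.natDegree_add_le _ _).trans (max_le_max hP hQ),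
      fun n => by simp [hP', hQ']⟩
  algebraMap_mem' c := by
    refine ⟨fun m => ⟨0, fun j _ => ⟨Polynomial.C (coeff m (algebraMap k k⟦X⟧ c)), ?_, ?_⟩⟩,
      fun j n _ => rfl⟩
    · simp
    · intro n
      simp

variable (k) in
/-- The function `j + (j - n - 1)`, that is, minus the weight of `b_j` minus one. -/
def sumFun : ℕ → ℤ → k⟦X⟧ := fun j n => C (2 * (j : k) - n - 1)

variable (k) in
/-- The classical colouring `j (n - j + 1)`. -/
def classicalFun : ℕ → ℤ → k⟦X⟧ := fun j n => C ((j : k) * ((n : k) - j + 1))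

theorem C_mem_regularSymmetric (f : ℕ → ℤ → k) (D : ℕ)
    (hf : ∀ j, ∃ p : Polynomial k, p.natDegree ≤ D ∧ ∀ n : ℤ, f j n = p.eval (n : k))
    (hs : ∀ j n : ℕ, f (n + j + 1) n = f j (-(n : ℤ) - 2)) :
    (fun j n => C (f j n)) ∈ regularSymmetric k := by
  refine ⟨fun m => ⟨D, fun j _ => ?_⟩, fun j n _ => by simp only [hs]⟩
  obtain ⟨p, hp, hp'⟩ := hf j
  by_cases hm : m = 0
  · exact ⟨p, hp, fun n => by simp [hm, hp']⟩
  · exact ⟨0, by simp, fun n => by simp [PowerSeries.coeff_C, hm]⟩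

theorem sumFun_mem : sumFun k ∈ regularSymmetric k := by
  refine C_mem_regularSymmetric _ 1 (fun j => ⟨Polynomial.C (2 * (j : k) - 1) - Polynomial.X,
    by compute_degree, fun n => ?_⟩) fun j n => ?_
  · simp
    ring
  · push_cast
    ring

theorem classicalFun_mem : classicalFun k ∈ regularSymmetric k := by
  refine C_mem_regularSymmetric _ 1 (fun j => ⟨Polynomial.C (j : k) *
    (Polynomial.X - Polynomial.C (j : k) + 1), by compute_degree, fun n => ?_⟩) fun j n => ?_
  · simp
  · push_cast
    ring

/-- Modulo `h^(m+1)` only the `g^a` with `a < N` survive. Since `N` does not depend on `j`, it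
bounds the degree in `n` for all `j` at once. -/
theorem Colouring.IsRegular.mem_regularSymmetric {ψ : Colouring k} (hψ : ψ.IsRegular) :
    ψ.toFun ∈ regularSymmetric k := by
  obtain ⟨g, hg, hg'⟩ := hψ
  refine ⟨fun m => ?_, fun j n hj => ψ.c3 j n hj⟩
  obtain ⟨N, hN⟩ := hg (m + 1)
  refine ⟨N, fun j hj => ⟨∑ a ∈ Finset.range N,
    Polynomial.C (coeff m (g a j)) * Polynomial.X ^ a, ?_, fun n => ?_⟩⟩
  · refine Polynomial.natDegree_sum_le_of_forall_le _ _ fun a ha => ?_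
    exact (Polynomial.natDegree_C_mul_X_pow_le _ _).trans (Finset.mem_range.1 ha).le
  · obtain ⟨N₁, hN₁⟩ := hg' j n hj (m + 1)
    have h1 : (X : k⟦X⟧) ^ (m + 1) ∣
        ψ.toFun j n - ∑ a ∈ Finset.range N, g a (j : ℤ) * (n : k⟦X⟧) ^ a := by
      have h2 := hN₁ (max N N₁) (le_max_right _ _)
      rw [← Finset.sum_range_add_sum_Ico _ (le_max_left N N₁), ← sub_sub] at h2
      have h3 : (X : k⟦X⟧) ^ (m + 1) ∣
          ∑ a ∈ Finset.Ico N (max N N₁), g a (j : ℤ) * (n : k⟦X⟧) ^ a :=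
        Finset.dvd_sum fun a ha => (hN a (Finset.mem_Ico.1 ha).1 j).mul_right _
      simpa using dvd_add h2 h3
    have h4 := X_pow_dvd_iff.1 h1 m (Nat.lt_succ_self m)
    rw [map_sub, sub_eq_zero] at h4
    rw [h4, map_sum, Polynomial.eval_finsetSum]
    refine Finset.sum_congr rfl fun a _ => ?_
    have h5 : (n : k⟦X⟧) ^ a = C ((n : k) ^ a) := by simp
    rw [h5, coeff_mul_C]
    simp

/-- The reduction modulo `h` of an element of `regularSymmetric` that satisfies (C2) is the
classical colouring times a polynomial in the weight and the classical colouring. -/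
theorem exists_constantCoeff_eq [CharZero k] {F : ℕ → ℤ → k⟦X⟧} (hF : F ∈ regularSymmetric k)
    (h2 : ∀ n : ℕ, F (n + 1) n = 0) :
    ∃ q : Polynomial (Polynomial k), ∀ (j : ℕ) (n : ℤ), 1 ≤ j →
      constantCoeff (F j n) = (j : k) * ((n : k) - j + 1) *
        q.evalEval (2 * (j : k) - n - 1) (-((j : k) * ((n : k) - j + 1))) := by
  obtain ⟨D, hD⟩ := hF.1 0
  have hD' : ∀ j, ∃ p : Polynomial k, 1 ≤ j → p.natDegree ≤ D ∧
      ∀ n : ℤ, constantCoeff (F j n) = p.eval (n : k) := by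
    intro j
    by_cases hj : 1 ≤ j
    · obtain ⟨p, hp⟩ := hD j hj
      exact ⟨p, fun _ => by simpa using hp⟩
    · exact ⟨0, fun h => absurd h hj⟩
  choose p hp using hD'
  have hsub : ∀ a : ℕ, ((Polynomial.C ((a : k) - 1) - Polynomial.X).natDegree ≤ 1) := by
    intro a
    compute_degree
  -- The substitution `n = a - 1 - b`, with `a = j`, turns (C3) into symmetry in `a` and `b`.
  have hval : ∀ a b : ℕ, 1 ≤ a →
      ((p a).comp (Polynomial.C ((a : k) - 1) - Polynomial.X)).eval (b : k) =
        constantCoeff (F a ((a : ℤ) - 1 - b)) := by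
    intro a b ha
    rw [(hp a ha).2]
    simp [Polynomial.eval_comp]
  have hlt : ∀ a b : ℕ, 1 ≤ b → b < a →
      F a ((a : ℤ) - 1 - b) = F b ((b : ℤ) - 1 - a) := by
    intro a b hb hab
    obtain ⟨n, rfl⟩ : ∃ n, a = n + b + 1 := ⟨a - b - 1, by omega⟩
    have h := hF.2 b n hb
    convert h using 2
    · push_cast
      ring
    · push_cast
      ring
  obtain ⟨q, hq⟩ := exists_evalEval_of_symm (D + 1)
    (fun a => (p a).comp (Polynomial.C ((a : k) - 1) - Polynomial.X)) (by
      intro a ha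
      left
      refine lt_of_le_of_lt Polynomial.natDegree_comp_le ?_
      have h1 := (hp a ha).1
      have h3 := hsub a
      nlinarith) (by
      intro a b ha hb
      rw [hval a b ha, hval b a hb]
      rcases lt_trichotomy a b with h | h | h
      · rw [hlt b a ha h]
      · rw [h]
      · rw [hlt a b hb h])
  -- (C2) is the case `b = 0`: there the product `ab` vanishes and the sum is `a`, so `q.coeff 0`
  -- has every positive integer as a root.
  have hq0 : q.coeff 0 = 0 := by
    refine Polynomial.eq_zero_of_infinite_isRoot _ (Set.Infinite.mono ?_
      (Set.infinite_range_of_injective (f := fun a : ℕ => ((a + 1 : ℕ) : k))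
        fun a b h => by simpa using Nat.cast_injective (R := k) h))
    rintro _ ⟨a, rfl⟩
    have h := hq (a + 1) (by omega) 0
    have h' := hval (a + 1) 0 (by omega)
    rw [Nat.cast_zero] at h'
    rw [h'] at h
    have h2a : F (a + 1) (((a + 1 : ℕ) : ℤ) - 1 - ((0 : ℕ) : ℤ)) = 0 := by
      rw [← h2 a]
      congr 1
      push_cast
      ring
    rw [h2a, map_zero, mul_zero, add_zero, Polynomial.evalEval, map_zero,
      ← Polynomial.coeff_zero_eq_eval_zero] at h
    exact h.symm
  have hqX : q = q.divX * Polynomial.X := by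
    conv_lhs => rw [← Polynomial.divX_mul_X_add q, hq0, map_zero, add_zero]
  -- The sign comes from `ab = -j(n-j+1)`.
  refine ⟨-q.divX, fun j n hj => ?_⟩
  have h := hq j hj ((j : k) - 1 - n)
  rw [Polynomial.eval_comp, hqX, Polynomial.evalEval_mul, Polynomial.evalEval_X] at h
  rw [(hp j hj).2, Polynomial.evalEval_neg]
  have e1 : (j : k) + (j - 1 - n) = 2 * (j : k) - n - 1 := by ring
  have e2 : (j : k) * (j - 1 - n) = -((j : k) * ((n : k) - j + 1)) := by ring
  have e3 : (Polynomial.C ((j : k) - 1) - Polynomial.X).eval ((j : k) - 1 - n) = (n : k) := by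
    simp
  rw [e1, e2, e3] at h
  rw [h]
  ring

/-! ### Successive approximation -/

section Approximation

variable {A : Type v} [Ring A] [Algebra k A] {V : Type w} [AddCommGroup V] [Module k V]

theorem X_smul_series (y : A⟦X⟧) : (X : k⟦X⟧) • y = X * y := by
  rw [Algebra.smul_def]
  congr 1
  exact PowerSeries.map_X _

theorem series_eq_C_add (x : A⟦X⟧) :
    x = C (coeff 0 x) + (X : k⟦X⟧) • mk fun m => coeff (m + 1) x := by
  rw [X_smul_series]
  ext m
  cases m with
  | zero => simp
  | succ m => simp [PowerSeries.coeff_succ_X_mul]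

/-- Each `d i` is divisible by every power of `h`, and `V⟦h⟧` is `h`-adically separated. -/
theorem HSeries.eq_zero_of_eq_X_smul (d : ℕ → HSeries V)
    (h : ∀ i, d i = (X : k⟦X⟧) • d (i + 1)) (i : ℕ) : d i = 0 := by
  have key : ∀ m i, (d i).cf m = 0 := by
    intro m
    induction m with
    | zero => intro i; rw [h, HSeries.X_smul_apply_zero]
    | succ m ih => intro i; rw [h, HSeries.X_smul_apply_succ, ih]
  exact HSeries.ext fun m => key m i

theorem HSeries.X_smul_injective {v : HSeries V} (h : (X : k⟦X⟧) • v = 0) : v = 0 := by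
  ext m
  rw [← HSeries.X_smul_apply_succ (k := k), h]
  rfl

/-- If `w i = u i + h w (i + 1)` where the `u i` act through `A⟦h⟧`, then `w 0` acts through
`A⟦h⟧`, too. -/
theorem exists_seriesAction_eq {ι : Type*} (ρ : ι → A →ₐ[k] Module.End k⟦X⟧ (HSeries V))
    (u : ℕ → A⟦X⟧) (w : ℕ → ι → Module.End k⟦X⟧ (HSeries V))
    (h : ∀ i n, w i n = seriesAction (ρ n) (u i) + (X : k⟦X⟧) • w (i + 1) n) :
    ∃ U : A⟦X⟧, ∀ n, seriesAction (ρ n) U = w 0 n := by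
  -- `U i` is the `h`-adically convergent series `∑ₚ h^p u (i + p)`. It does not involve the index
  -- of the representation, so a single element serves the whole family.
  let U : ℕ → A⟦X⟧ := fun i => mk fun N =>
    ∑ p ∈ Finset.HasAntidiagonal.antidiagonal N, coeff p.2 (u (i + p.1))
  have hU : ∀ i, U i = u i + (X : k⟦X⟧) • U (i + 1) := by
    intro i
    rw [X_smul_series]
    ext N
    cases N with
    | zero => simp [U]
    | succ N =>
      rw [map_add, PowerSeries.coeff_succ_X_mul]
      simp only [U, coeff_mk, Finset.Nat.antidiagonal_succ, Finset.sum_cons, Finset.sum_map]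
      congr 1
      refine Finset.sum_congr rfl fun p _ => ?_
      simp only [Function.Embedding.prodMap, Function.Embedding.coeFn_mk, Prod.map,
        Function.Embedding.refl_apply]
      congr 2
      simp
      ring
  refine ⟨U 0, fun n => LinearMap.ext fun v => ?_⟩
  have h0 := HSeries.eq_zero_of_eq_X_smul (k := k)
    (fun i => seriesAction (ρ n) (U i) v - w i n v) (fun i => by
      rw [hU i, h i n, map_add, map_smul, LinearMap.add_apply, LinearMap.add_apply,
        LinearMap.smul_apply, LinearMap.smul_apply, smul_sub]
      abel) 0
  exact sub_eq_zero.1 h0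

end Approximation

/-! ### Operators of weight two on the deformed Verma modules -/

/-- The operator `b_j ↦ F^j(n) b_{j-1}`. -/
def lower (F : ℕ → ℤ → k⟦X⟧) (n : ℤ) : Module.End k⟦X⟧ (VermaSpace k) :=
  opOfBasis fun j => if j = 0 then 0 else F j n • b k (j - 1)

theorem lower_b_zero (F : ℕ → ℤ → k⟦X⟧) (n : ℤ) : lower F n (b k 0) = 0 := by simp [lower]

theorem lower_b_succ (F : ℕ → ℤ → k⟦X⟧) (n : ℤ) (j : ℕ) :
    lower F n (b k (j + 1)) = F (j + 1) n • b k j := by simp [lower]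

theorem vermaRep_gen (ψ : Colouring k) (n : ℤ) (x : Gen) :
    vermaRep ψ n (Ua.gen k x) = vermaOp ψ n x := by
  simp [vermaRep]

theorem vermaOp_Xp (ψ : Colouring k) (n : ℤ) : vermaOp ψ n Gen.Xp = lower ψ.toFun n := rfl

theorem vermaOp_H_b (ψ : Colouring k) (n : ℤ) (j : ℕ) :
    vermaOp ψ n Gen.H (b k j) = ((n : k) - 2 * j) • b k j := by simp [vermaOp]

theorem vermaOp_Xm_b (ψ : Colouring k) (n : ℤ) (j : ℕ) :
    vermaOp ψ n Gen.Xm (b k j) = b k (j + 1) := by simp [vermaOp]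

/-- The functions `F` such that some element of `U(𝔞)` acts by `b_j ↦ F^j(n) b_j` on all the deformed
Verma modules. -/
def diagonalFun (ψ : Colouring k) : Subalgebra k (ℕ → ℤ → k⟦X⟧) where
  carrier := {F | ∃ x : Ua k, ∀ n j, vermaRep ψ n x (b k j) = F j n • b k j}
  mul_mem' := by
    rintro F G ⟨x, hx⟩ ⟨y, hy⟩
    refine ⟨x * y, fun n j => ?_⟩
    rw [map_mul, Module.End.mul_apply, hy, map_smul, hx, smul_smul, mul_comm]
    rfl
  add_mem' := by
    rintro F G ⟨x, hx⟩ ⟨y, hy⟩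
    refine ⟨x + y, fun n j => ?_⟩
    rw [map_add, LinearMap.add_apply, hx, hy, ← add_smul]
    rfl
  algebraMap_mem' c := by
    refine ⟨algebraMap k _ c, fun n j => ?_⟩
    rw [AlgHom.commutes, Module.algebraMap_end_apply]
    exact (algebraMap_smul k⟦X⟧ c (b k j)).symm

theorem sumFun_mem_diagonalFun (ψ : Colouring k) : sumFun k ∈ diagonalFun ψ := by
  refine ⟨-Ua.gen k Gen.H - 1, fun n j => ?_⟩
  rw [map_sub, map_neg, map_one, vermaRep_gen, LinearMap.sub_apply, LinearMap.neg_apply,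
    vermaOp_H_b, Module.End.one_apply]
  have h : sumFun k j n • b k j = (2 * (j : k) - n - 1) • b k j :=
    algebraMap_smul k⟦X⟧ (2 * (j : k) - n - 1) (b k j)
  rw [h]
  module

/-- The colouring `ψ`, with the entries `ψ^0(n)` replaced by zero. -/
def Colouring.zeroed (ψ : Colouring k) : ℕ → ℤ → k⟦X⟧ := fun j n => if j = 0 then 0 else ψ.toFun j n

theorem Colouring.zeroed_of_pos (ψ : Colouring k) {j : ℕ} (hj : 1 ≤ j) (n : ℤ) :
    ψ.zeroed j n = ψ.toFun j n := if_neg (by omega)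

theorem Colouring.IsRegular.zeroed_mem {ψ : Colouring k} (hψ : ψ.IsRegular) :
    ψ.zeroed ∈ regularSymmetric k := by
  obtain ⟨h1, h2⟩ := hψ.mem_regularSymmetric
  refine ⟨fun m => ?_, fun j n hj => ?_⟩
  · obtain ⟨D, hD⟩ := h1 m
    refine ⟨D, fun j hj => ?_⟩
    obtain ⟨p, hp, hp'⟩ := hD j hj
    exact ⟨p, hp, fun n => by rw [ψ.zeroed_of_pos hj, hp']⟩
  · rw [ψ.zeroed_of_pos hj, ψ.zeroed_of_pos (by omega), h2 j n hj]

/-- The diagonal operator is `X⁻X⁺`. It kills `b_0`, whereas `ψ^0(n)` is arbitrary; this is why the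
entries at `j = 0` are replaced by zero. -/
theorem Colouring.zeroed_mem_diagonalFun (ψ : Colouring k) : ψ.zeroed ∈ diagonalFun ψ := by
  refine ⟨Ua.gen k Gen.Xm * Ua.gen k Gen.Xp, fun n j => ?_⟩
  rw [map_mul, vermaRep_gen, vermaRep_gen, Module.End.mul_apply, vermaOp_Xp]
  cases j with
  | zero =>
    rw [lower_b_zero, map_zero]
    exact (zero_smul k⟦X⟧ (b k 0)).symm
  | succ j => rw [lower_b_succ, map_smul, vermaOp_Xm_b, ψ.zeroed_of_pos (by omega)]

/-- Applied to `regularSymmetric` and to `diagonalFun`: a polynomial in the weight and the colouring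
stays regular and symmetric, and remains the diagonal action of an element of `U(𝔞)`. -/
theorem aevalAeval_mem {B : Type*} [CommRing B] [Algebra k B] (S : Subalgebra k B) {x y : B}
    (hx : x ∈ S) (hy : y ∈ S) (q : Polynomial (Polynomial k)) :
    Polynomial.aevalAeval x y q ∈ S := by
  have h : (Polynomial.aevalAeval x y : _ →ₐ[k] B) =
      S.val.comp (Polynomial.aevalAeval (⟨x, hx⟩ : S) ⟨y, hy⟩) := by
    apply (Polynomial.aevalAevalEquiv k B).symm.injective
    rw [Equiv.symm_apply_apply]
    simp [Polynomial.aevalAevalEquiv_symm_apply]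
  rw [h]
  exact Subtype.property _

theorem map_aevalAeval {B B' : Type*} [CommRing B] [Algebra k B] [CommRing B'] [Algebra k B']
    (f : B →ₐ[k] B') (x y : B) (q : Polynomial (Polynomial k)) :
    f (Polynomial.aevalAeval x y q) = Polynomial.aevalAeval (f x) (f y) q := by
  have h : (Polynomial.aevalAeval (f x) (f y) : _ →ₐ[k] B') =
      f.comp (Polynomial.aevalAeval x y) := by
    apply (Polynomial.aevalAevalEquiv k B').symm.injective
    rw [Equiv.symm_apply_apply]
    simp [Polynomial.aevalAevalEquiv_symm_apply]
  rw [h]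
  rfl

variable (k) in
/-- The reduction modulo `h` of the value at `(j, n)`. -/
def redEval (j : ℕ) (n : ℤ) : (ℕ → ℤ → k⟦X⟧) →ₐ[k] k where
  toFun F := constantCoeff (F j n)
  map_one' := by simp
  map_mul' _ _ := by simp
  map_zero' := by simp
  map_add' _ _ := by simp
  commutes' c := constantCoeff_C c

/-- Division by `h`, up to the constant term. -/
def shiftFun (F : ℕ → ℤ → k⟦X⟧) : ℕ → ℤ → k⟦X⟧ := fun j n => mk fun m => coeff (m + 1) (F j n)

theorem eq_C_add_X_mul_shiftFun (F : ℕ → ℤ → k⟦X⟧) (j : ℕ) (n : ℤ) :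
    F j n = C (constantCoeff (F j n)) + X * shiftFun F j n := by
  ext m
  cases m with
  | zero => simp
  | succ m => simp [PowerSeries.coeff_succ_X_mul, shiftFun]

theorem shiftFun_mem {F : ℕ → ℤ → k⟦X⟧} (hF : F ∈ regularSymmetric k) :
    shiftFun F ∈ regularSymmetric k := by
  refine ⟨fun m => ?_, fun j n hj => by simp only [shiftFun, hF.2 j n hj]⟩
  obtain ⟨D, hD⟩ := hF.1 (m + 1)
  exact ⟨D, fun j hj => by simpa [shiftFun] using hD j hj⟩

/-- One step of the approximation. The remainder `F'` satisfies the same conditions as `F`, so the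
step can be repeated. -/
theorem exists_lower_eq_add [CharZero k] {ψ : Colouring k} (hψ : ψ.IsRegular) {F : ℕ → ℤ → k⟦X⟧}
    (hF : F ∈ regularSymmetric k) (h2 : ∀ n : ℕ, F (n + 1) n = 0) :
    ∃ x : Ua k, ∃ F' ∈ regularSymmetric k, (∀ n : ℕ, F' (n + 1) n = 0) ∧
      ∀ n, lower F n = vermaRep ψ n x + (X : k⟦X⟧) • lower F' n := by
  obtain ⟨q, hq⟩ := exists_constantCoeff_eq hF h2
  -- The polynomial `q` is evaluated at `ψ` instead of the classical colouring. This changes nothing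
  -- modulo `h`, by (C1), and makes `Q` the diagonal action of `d = q(-H-1, -X⁻X⁺)`; the element
  -- sought is `X⁺ d`.
  let Q : ℕ → ℤ → k⟦X⟧ := Polynomial.aevalAeval (sumFun k) (-ψ.zeroed) q
  have hQ : Q ∈ regularSymmetric k := aevalAeval_mem _ sumFun_mem (neg_mem hψ.zeroed_mem) q
  obtain ⟨d, hd⟩ : Q ∈ diagonalFun ψ :=
    aevalAeval_mem _ (sumFun_mem_diagonalFun ψ) (neg_mem ψ.zeroed_mem_diagonalFun) q
  have hc : ∀ (j : ℕ) (n : ℤ), 1 ≤ j → constantCoeff ((F - Q * ψ.zeroed) j n) = 0 := by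
    intro j n hj
    have hQ0 : constantCoeff (Q j n) =
        q.evalEval (2 * (j : k) - n - 1) (-((j : k) * ((n : k) - j + 1))) := by
      have h := map_aevalAeval (redEval k j n) (sumFun k) (-ψ.zeroed) q
      have h1 : redEval k j n (sumFun k) = 2 * (j : k) - n - 1 := constantCoeff_C _
      have h3 : redEval k j n (-ψ.zeroed) = -((j : k) * ((n : k) - j + 1)) := by
        change constantCoeff (-ψ.zeroed j n) = _
        rw [map_neg, ψ.zeroed_of_pos hj, ψ.c1 j n hj]
      rw [Polynomial.coe_aevalAeval_eq_evalEval, h1, h3] at h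
      exact h
    change constantCoeff (F j n - Q j n * ψ.zeroed j n) = 0
    rw [map_sub, map_mul, hQ0, ψ.zeroed_of_pos hj, ψ.c1 j n hj, hq j n hj]
    ring
  refine ⟨Ua.gen k Gen.Xp * d, shiftFun (F - Q * ψ.zeroed),
    shiftFun_mem (sub_mem hF (mul_mem hQ hψ.zeroed_mem)), fun n => ?_, fun n => op_ext fun j => ?_⟩
  · have h : (F - Q * ψ.zeroed) (n + 1) n = 0 := by
      change F (n + 1) n - Q (n + 1) n * ψ.zeroed (n + 1) n = 0
      rw [h2, ψ.zeroed_of_pos (by omega), ψ.c2, mul_zero, sub_zero]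
    ext m
    simp [shiftFun, h]
  · rw [LinearMap.add_apply, LinearMap.smul_apply, map_mul, Module.End.mul_apply, hd, map_smul,
      vermaRep_gen, vermaOp_Xp]
    cases j with
    | zero => simp [lower_b_zero]
    | succ j =>
      rw [lower_b_succ, lower_b_succ, lower_b_succ, smul_smul, smul_smul, ← add_smul]
      congr 1
      have h := eq_C_add_X_mul_shiftFun (F - Q * ψ.zeroed) (j + 1) n
      rw [hc (j + 1) n (by omega), map_zero, zero_add] at h
      rw [← h, ← ψ.zeroed_of_pos (by omega)]
      change _ = _ + (F (j + 1) n - Q (j + 1) n * ψ.zeroed (j + 1) n)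
      ring

theorem exists_vermaRepH_eq_lower [CharZero k] {ψ : Colouring k} (hψ : ψ.IsRegular)
    {F : ℕ → ℤ → k⟦X⟧} (hF : F ∈ regularSymmetric k) (h2 : ∀ n : ℕ, F (n + 1) n = 0) :
    ∃ z : (Ua k)⟦X⟧, ∀ n, vermaRepH ψ n z = lower F n := by
  have step : ∀ G : {G : ℕ → ℤ → k⟦X⟧ // G ∈ regularSymmetric k ∧ ∀ n : ℕ, G (n + 1) n = 0},
      ∃ x : Ua k, ∃ G' : {G : ℕ → ℤ → k⟦X⟧ // G ∈ regularSymmetric k ∧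
        ∀ n : ℕ, G (n + 1) n = 0}, ∀ n, lower G.1 n =
          vermaRep ψ n x + (X : k⟦X⟧) • lower G'.1 n := by
    rintro ⟨G, hG, hG2⟩
    obtain ⟨x, G', h1, h2, h3⟩ := exists_lower_eq_add hψ hG hG2
    exact ⟨x, ⟨G', h1, h2⟩, h3⟩
  choose x next hnext using step
  let G := fun i => next^[i] ⟨F, hF, h2⟩
  obtain ⟨U, hU⟩ := exists_seriesAction_eq (vermaRep ψ) (fun i => C (x (G i)))
    (fun i n => lower (G i).1 n) (fun i n => by
      rw [seriesAction_C, hnext (G i) n]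
      simp only [G, Function.iterate_succ_apply'])
  exact ⟨U, hU⟩

/-- The classical colouring and `ψ` both satisfy (C2) and (C3) and agree modulo `h` by (C1). Their
difference divided by `h` is therefore realized by some `z`, and `X⁺ + h z` satisfies the undeformed
relations. -/
theorem exists_lower_classicalFun_eq [CharZero k] {ψ : Colouring k} (hψ : ψ.IsRegular) :
    ∃ z : (Ua k)⟦X⟧, ∀ n, lower (classicalFun k) n =
      vermaOp ψ n Gen.Xp + (X : k⟦X⟧) • vermaRepH ψ n z := by
  obtain ⟨z, hz⟩ := exists_vermaRepH_eq_lower hψ (F := shiftFun (classicalFun k - ψ.toFun))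
    (shiftFun_mem (sub_mem classicalFun_mem hψ.mem_regularSymmetric)) (fun n => by
      have h : (classicalFun k - ψ.toFun) (n + 1) n = 0 := by
        change classicalFun k (n + 1) n - ψ.toFun (n + 1) n = 0
        rw [ψ.c2, sub_zero]
        simp [classicalFun]
      ext m
      simp [shiftFun, h])
  refine ⟨z, fun n => op_ext fun j => ?_⟩
  rw [hz, vermaOp_Xp, LinearMap.add_apply, LinearMap.smul_apply]
  cases j with
  | zero => simp [lower_b_zero]
  | succ j =>
    rw [lower_b_succ, lower_b_succ, lower_b_succ, smul_smul, ← add_smul]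
    congr 1
    have h := eq_C_add_X_mul_shiftFun (classicalFun k - ψ.toFun) (j + 1) n
    have h0 : constantCoeff ((classicalFun k - ψ.toFun) (j + 1) n) = 0 := by
      change constantCoeff (classicalFun k (j + 1) n - ψ.toFun (j + 1) n) = 0
      rw [map_sub, ψ.c1 _ _ (by omega), classicalFun, constantCoeff_C, sub_self]
    rw [h0, map_zero, zero_add] at h
    rw [← h]
    change _ = ψ.toFun (j + 1) n + (classicalFun k (j + 1) n - ψ.toFun (j + 1) n)
    ring

/-! ### Homomorphisms out of `U(𝔰𝔩₂)` -/

section USl2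

attribute [local instance 100] LieRing.ofAssociativeRing

theorem sl2_eq (x : Sl2 k) : x = x.1 0 0 • sl2Gen k Gen.H + x.1 1 0 • sl2Gen k Gen.Xm +
    x.1 0 1 • sl2Gen k Gen.Xp := by
  have htr : x.1 0 0 + x.1 1 1 = 0 := by
    have h : Matrix.trace x.1 = 0 := LinearMap.mem_ker.1 x.2
    rwa [Matrix.trace_fin_two] at h
  apply Subtype.ext
  ext i j
  fin_cases i <;> fin_cases j <;> simp [sl2Gen]
  linear_combination htr

theorem sl2Gen_lie_Xp_Xm : ⁅sl2Gen k Gen.Xp, sl2Gen k Gen.Xm⁆ = sl2Gen k Gen.H := by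
  apply Subtype.ext
  ext i j
  fin_cases i <;> fin_cases j <;>
    simp [sl2Gen, LieRing.of_associative_ring_bracket]

theorem USl2.gen_Xp_mul_Xm : USl2.gen k Gen.Xp * USl2.gen k Gen.Xm =
    USl2.gen k Gen.Xm * USl2.gen k Gen.Xp + USl2.gen k Gen.H := by
  have h := (UniversalEnvelopingAlgebra.ι k).map_lie (sl2Gen k Gen.Xp) (sl2Gen k Gen.Xm)
  rw [sl2Gen_lie_Xp_Xm, LieRing.of_associative_ring_bracket] at h
  rw [add_comm, ← sub_eq_iff_eq_add]
  exact h.symm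

theorem USl2.gen_Xp_mul_H : USl2.gen k Gen.Xp * USl2.gen k Gen.H =
    (USl2.gen k Gen.H - algebraMap k _ 2) * USl2.gen k Gen.Xp := by
  have h := USl2.rel_of_lie k _ _ _ (sl2Gen_lie_H_Xp k)
  rw [sub_mul, ← Algebra.smul_def, ← h]
  abel

theorem USl2.gen_H_mul_Xm : USl2.gen k Gen.H * USl2.gen k Gen.Xm =
    USl2.gen k Gen.Xm * (USl2.gen k Gen.H - algebraMap k _ 2) := by
  have h := USl2.rel_of_lie k _ _ _ (sl2Gen_lie_H_Xm k)
  rw [mul_sub, ← Algebra.commutes, ← Algebra.smul_def, sub_eq_add_neg, ← neg_smul, ← h]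
  abel

theorem USl2.algHom_ext {B : Type v} [Ring B] [Algebra k B] {F G : USl2 k →ₐ[k] B}
    (h : ∀ x, F (USl2.gen k x) = G (USl2.gen k x)) : F = G := by
  apply UniversalEnvelopingAlgebra.hom_ext
  ext x
  change F (UniversalEnvelopingAlgebra.ι k x) = G (UniversalEnvelopingAlgebra.ι k x)
  rw [sl2_eq x]
  simp only [map_add, map_smul]
  have h1 := h Gen.H
  have h2 := h Gen.Xm
  have h3 := h Gen.Xp
  simp only [USl2.gen] at h1 h2 h3
  rw [h1, h2, h3]

variable (k) in
/-- The algebra homomorphism out of `U(𝔰𝔩₂)` with prescribed values on the generators. -/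
def USl2.lift {B : Type v} [Ring B] [Algebra k B] (f : Gen → B)
    (hp : f Gen.H * f Gen.Xp - f Gen.Xp * f Gen.H = (2 : k) • f Gen.Xp)
    (hm : f Gen.H * f Gen.Xm - f Gen.Xm * f Gen.H = (-2 : k) • f Gen.Xm)
    (hpm : f Gen.Xp * f Gen.Xm - f Gen.Xm * f Gen.Xp = f Gen.H) : USl2 k →ₐ[k] B :=
  UniversalEnvelopingAlgebra.lift k
    { toFun := fun x => x.1 0 0 • f Gen.H + x.1 1 0 • f Gen.Xm + x.1 0 1 • f Gen.Xp
      map_add' := by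
        intro x y
        have h : ∀ i j, (x + y).1 i j = x.1 i j + y.1 i j := fun _ _ => rfl
        simp only [h]
        module
      map_smul' := by
        intro c x
        have h : ∀ i j, (c • x).1 i j = c * x.1 i j := fun _ _ => rfl
        simp only [h, RingHom.id_apply]
        module
      map_lie' := by
        intro x y
        have htr : ∀ x : Sl2 k, x.1 1 1 = -x.1 0 0 := by
          intro x
          have h : Matrix.trace x.1 = 0 := LinearMap.mem_ker.1 x.2
          rw [Matrix.trace_fin_two] at h
          linear_combination h
        have hp' := sub_eq_iff_eq_add.1 hp
        have hm' := sub_eq_iff_eq_add.1 hm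
        have hpm' := sub_eq_iff_eq_add.1 hpm
        have hxy : ∀ i j, (⁅x, y⁆ : Sl2 k).1 i j = (x.1 * y.1 - y.1 * x.1) i j := fun _ _ => rfl
        simp only [hxy, LieRing.of_associative_ring_bracket, Matrix.sub_apply, Matrix.mul_apply, Fin.sum_univ_two, htr, mul_add, add_mul,
          smul_mul_assoc, mul_smul_comm, hp', hm', hpm', smul_add]
        module }

theorem USl2.lift_gen {B : Type v} [Ring B] [Algebra k B] (f : Gen → B)
    (hp : f Gen.H * f Gen.Xp - f Gen.Xp * f Gen.H = (2 : k) • f Gen.Xp)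
    (hm : f Gen.H * f Gen.Xm - f Gen.Xm * f Gen.H = (-2 : k) • f Gen.Xm)
    (hpm : f Gen.Xp * f Gen.Xm - f Gen.Xm * f Gen.Xp = f Gen.H) (x : Gen) :
    USl2.lift k f hp hm hpm (USl2.gen k x) = f x := by
  rw [USl2.lift, USl2.gen, UniversalEnvelopingAlgebra.lift_ι_apply]
  change (sl2Gen k x).1 0 0 • f Gen.H + (sl2Gen k x).1 1 0 • f Gen.Xm +
    (sl2Gen k x).1 0 1 • f Gen.Xp = f x
  cases x <;> simp [sl2Gen]

/-- By the universal property the generators define a homomorphism into `S`; followed by the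
inclusion it fixes the generators, so it is the identity. -/
theorem USl2.mem_of_gen_mem (S : Subalgebra k (USl2 k)) (h : ∀ x, USl2.gen k x ∈ S) (u : USl2 k) :
    u ∈ S := by
  have hF : S.val.comp (USl2.lift k (fun x => (⟨USl2.gen k x, h x⟩ : S))
      (Subtype.ext (USl2.rel_of_lie k _ _ _ (sl2Gen_lie_H_Xp k)))
      (Subtype.ext (USl2.rel_of_lie k _ _ _ (sl2Gen_lie_H_Xm k)))
      (Subtype.ext (sub_eq_iff_eq_add'.2 USl2.gen_Xp_mul_Xm))) = AlgHom.id k _ :=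
    USl2.algHom_ext fun x => by
      rw [AlgHom.comp_apply, USl2.lift_gen]
      rfl
  have h' := AlgHom.congr_fun hF u
  rw [AlgHom.id_apply] at h'
  rw [← h']
  exact Subtype.property _

end USl2

/-! ### The standard monomials span `U(𝔰𝔩₂)` -/

open Polynomial in
theorem USl2.Xp_mul_aeval (p : k[X]) : gen k Gen.Xp * aeval (gen k Gen.H) p =
    aeval (gen k Gen.H) (p.comp (Polynomial.X - Polynomial.C 2)) * gen k Gen.Xp := by
  induction p using Polynomial.induction_on' with
  | add p q hp hq => rw [map_add, mul_add, hp, hq, add_comp, map_add, add_mul]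
  | monomial n a =>
    rw [aeval_monomial, monomial_comp, map_mul, map_pow, map_sub, aeval_X, aeval_C, aeval_C,
      ← mul_assoc, ← Algebra.commutes, mul_assoc, mul_assoc]
    congr 1
    induction n with
    | zero => simp
    | succ n ih => rw [pow_succ, ← mul_assoc, ih, mul_assoc, USl2.gen_Xp_mul_H, ← mul_assoc,
        ← pow_succ]

theorem USl2.H_mul_Xm_pow (i : ℕ) : gen k Gen.H * gen k Gen.Xm ^ i =
    gen k Gen.Xm ^ i * (gen k Gen.H - algebraMap k _ (2 * (i : k))) := by
  induction i with
  | zero => simp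
  | succ i ih =>
    rw [pow_succ, ← mul_assoc, ih, mul_assoc, sub_mul, USl2.gen_H_mul_Xm, Algebra.commutes,
      ← mul_sub, sub_sub, ← map_add, mul_assoc]
    congr 4
    push_cast
    ring

theorem USl2.Xp_mul_Xm_pow (i : ℕ) : gen k Gen.Xp * gen k Gen.Xm ^ (i + 1) =
    gen k Gen.Xm ^ (i + 1) * gen k Gen.Xp + gen k Gen.Xm ^ i *
      (algebraMap k _ ((i : k) + 1) * (gen k Gen.H - algebraMap k _ (i : k))) := by
  induction i with
  | zero => simp [USl2.gen_Xp_mul_Xm]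
  | succ i ih =>
    have e1 : (gen k Gen.H - algebraMap k (USl2 k) (i : k)) * gen k Gen.Xm =
        gen k Gen.Xm * (gen k Gen.H - algebraMap k _ ((i : k) + 2)) := by
      rw [sub_mul, USl2.gen_H_mul_Xm, Algebra.commutes, ← mul_sub, sub_sub, ← map_add, add_comm]
    rw [pow_succ _ (i + 1), ← mul_assoc, ih, add_mul, mul_assoc _ (gen k Gen.Xp),
      USl2.gen_Xp_mul_Xm, mul_assoc (gen k Gen.Xm ^ i), mul_assoc (algebraMap k _ _), e1,
      ← mul_assoc (algebraMap k _ _), Algebra.commutes ((i : k) + 1) (gen k Gen.Xm),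
      mul_assoc (gen k Gen.Xm), ← mul_assoc (gen k Gen.Xm ^ i) (gen k Gen.Xm), ← pow_succ, mul_add,
      add_assoc, ← mul_assoc, ← mul_add]
    congr 2
    simp only [mul_sub, ← map_mul]
    have e2 : algebraMap k (USl2 k) (((i + 1 : ℕ) : k) + 1) =
        1 + algebraMap k (USl2 k) ((i : k) + 1) := by
      rw [Nat.cast_succ, map_add _ _ 1, map_one, add_comm]
    rw [e2, add_mul (1 : USl2 k), one_mul, add_sub_assoc]
    congr 3
    push_cast
    ring

variable (k) in
/-- The family of coefficients `p_{i,m}` is sent to `∑ (X⁻)^i p_{i,m}(H) (X⁺)^m`. -/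
def standardSum : (ℕ × ℕ →₀ Polynomial k) →ₗ[k] USl2 k :=
  Finsupp.lsum k fun x => (LinearMap.mulRight k (USl2.gen k Gen.Xp ^ x.2)).comp
    ((LinearMap.mulLeft k (USl2.gen k Gen.Xm ^ x.1)).comp
      (Polynomial.aeval (USl2.gen k Gen.H)).toLinearMap)

theorem standardSum_single (i m : ℕ) (p : Polynomial k) : standardSum k (Finsupp.single (i, m) p) =
    USl2.gen k Gen.Xm ^ i * Polynomial.aeval (USl2.gen k Gen.H) p * USl2.gen k Gen.Xp ^ m := by
  simp [standardSum]

/-- This is the spanning half of the Poincaré–Birkhoff–Witt theorem. Independence is not needed: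
faithfulness on Verma modules is proved directly for a standard sum. -/
theorem standardSum_surjective : Function.Surjective (standardSum k) := by
  have hmem : ∀ (i m : ℕ) (p : Polynomial k), USl2.gen k Gen.Xm ^ i *
      Polynomial.aeval (USl2.gen k Gen.H) p * USl2.gen k Gen.Xp ^ m ∈
        LinearMap.range (standardSum k) := fun i m p =>
    ⟨_, standardSum_single i m p⟩
  -- The elements whose left multiplication preserves the span form a subalgebra. It suffices to
  -- test the generators and then to apply the result to `1`.
  let S : Subalgebra k (USl2 k) :=
    { carrier := {u | ∀ y ∈ LinearMap.range (standardSum k),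
        u * y ∈ LinearMap.range (standardSum k)}
      mul_mem' := fun {u v} hu hv y hy => by
        rw [mul_assoc]
        exact hu _ (hv _ hy)
      add_mem' := fun {u v} hu hv y hy => by
        rw [add_mul]
        exact add_mem (hu _ hy) (hv _ hy)
      algebraMap_mem' := fun c y hy => by
        rw [← Algebra.smul_def]
        exact Submodule.smul_mem _ _ hy }
  have hS : ∀ u : USl2 k, (∀ (i m : ℕ) (p : Polynomial k), u * (USl2.gen k Gen.Xm ^ i *
      Polynomial.aeval (USl2.gen k Gen.H) p * USl2.gen k Gen.Xp ^ m) ∈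
        LinearMap.range (standardSum k)) → u ∈ S := by
    rintro u hu _ ⟨c, rfl⟩
    induction c using Finsupp.induction_linear with
    | zero => simp
    | add c d hc hd =>
      rw [map_add, mul_add]
      exact add_mem hc hd
    | single x p =>
      rw [standardSum_single]
      exact hu _ _ _
  intro u
  have hu : u ∈ S := by
    refine USl2.mem_of_gen_mem S (fun x => hS _ fun i m p => ?_) u
    cases x with
    | H =>
      rw [← mul_assoc, ← mul_assoc, USl2.H_mul_Xm_pow, mul_assoc (USl2.gen k Gen.Xm ^ i)]
      have h := hmem i m ((Polynomial.X - Polynomial.C (2 * (i : k))) * p)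
      rwa [map_mul, map_sub, Polynomial.aeval_X, Polynomial.aeval_C] at h
    | Xm =>
      rw [← mul_assoc, ← mul_assoc, ← pow_succ']
      exact hmem _ _ _
    | Xp =>
      have h1 := hmem i (m + 1) (p.comp (Polynomial.X - Polynomial.C 2))
      rw [pow_succ' _ m, ← mul_assoc, mul_assoc (USl2.gen k Gen.Xm ^ i),
        ← USl2.Xp_mul_aeval] at h1
      cases i with
      | zero =>
        simpa [mul_assoc] using h1
      | succ i =>
        have h2 := hmem i m (Polynomial.C ((i : k) + 1) * (Polynomial.X - Polynomial.C (i : k)) * p)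
        rw [map_mul, map_mul, map_sub, Polynomial.aeval_X, Polynomial.aeval_C,
          Polynomial.aeval_C] at h2
        have h := add_mem h1 h2
        rw [← add_mul, ← mul_assoc _ (USl2.gen k Gen.Xp), ← mul_assoc _ (_ * _), ← add_mul,
          ← USl2.Xp_mul_Xm_pow] at h
        rwa [← mul_assoc, ← mul_assoc]
  have h1 : (1 : USl2 k) ∈ LinearMap.range (standardSum k) := by simpa using hmem 0 0 1
  simpa using hu 1 h1

/-! ### Verma modules of `𝔰𝔩₂` -/

variable (k) in
/-- The action of the Chevalley generators on the Verma module of `𝔰𝔩₂` of highest weight `n`. -/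
def stdOp (n : ℤ) : Gen → Module.End k⟦X⟧ (VermaSpace k)
  | Gen.H => opOfBasis fun j => ((n : k) - 2 * (j : k)) • b k j
  | Gen.Xm => opOfBasis fun j => b k (j + 1)
  | Gen.Xp => lower (classicalFun k) n

theorem stdOp_H_b (n : ℤ) (j : ℕ) : stdOp k n Gen.H (b k j) = ((n : k) - 2 * j) • b k j := by
  simp [stdOp]

theorem stdOp_Xm_b (n : ℤ) (j : ℕ) : stdOp k n Gen.Xm (b k j) = b k (j + 1) := by simp [stdOp]

theorem stdOp_Xp_b_zero (n : ℤ) : stdOp k n Gen.Xp (b k 0) = 0 := lower_b_zero _ n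

theorem stdOp_Xp_b_succ (n : ℤ) (j : ℕ) :
    stdOp k n Gen.Xp (b k (j + 1)) = (((j : k) + 1) * ((n : k) - j)) • b k j := by
  have h : lower (classicalFun k) n (b k (j + 1)) =
      (((j + 1 : ℕ) : k) * ((n : k) - (j + 1 : ℕ) + 1)) • b k j := by
    rw [lower_b_succ]
    exact algebraMap_smul k⟦X⟧ _ (b k j)
  refine h.trans ?_
  congr 1
  push_cast
  ring

variable (k) in
/-- The Verma module of `𝔰𝔩₂` of highest weight `n`, with coefficients extended to `k⟦h⟧`. -/
def stdRep (n : ℤ) : USl2 k →ₐ[k] Module.End k⟦X⟧ (VermaSpace k) :=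
  USl2.lift k (stdOp k n)
    (op_ext fun j => by
      cases j with
      | zero => simp [stdOp_H_b, stdOp_Xp_b_zero, LinearMap.map_smul_of_tower]
      | succ j =>
        simp only [LinearMap.sub_apply, Module.End.mul_apply, stdOp_H_b, stdOp_Xp_b_succ,
          LinearMap.smul_apply, LinearMap.map_smul_of_tower]
        push_cast
        module)
    (op_ext fun j => by
      simp only [LinearMap.sub_apply, Module.End.mul_apply, stdOp_H_b, stdOp_Xm_b,
        LinearMap.smul_apply, LinearMap.map_smul_of_tower]
      push_cast
      module)
    (op_ext fun j => by
      cases j with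
      | zero => simp [stdOp_H_b, stdOp_Xm_b, stdOp_Xp_b_zero, stdOp_Xp_b_succ]
      | succ j =>
        simp only [LinearMap.sub_apply, Module.End.mul_apply, stdOp_H_b, stdOp_Xm_b,
          stdOp_Xp_b_succ, LinearMap.map_smul_of_tower]
        push_cast
        module)

theorem stdRep_gen (n : ℤ) (x : Gen) : stdRep k n (USl2.gen k x) = stdOp k n x :=
  USl2.lift_gen _ _ _ _ x

theorem stdRep_Xm_pow_b (n : ℤ) (i j : ℕ) :
    stdRep k n (USl2.gen k Gen.Xm ^ i) (b k j) = b k (j + i) := by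
  induction i with
  | zero => simp
  | succ i ih => rw [pow_succ', map_mul, Module.End.mul_apply, ih, stdRep_gen, stdOp_Xm_b]; rfl

theorem stdRep_aeval_b (n : ℤ) (p : Polynomial k) (j : ℕ) :
    stdRep k n (Polynomial.aeval (USl2.gen k Gen.H) p) (b k j) =
      p.eval ((n : k) - 2 * j) • b k j := by
  rw [← Polynomial.aeval_algHom_apply, stdRep_gen]
  induction p using Polynomial.induction_on' with
  | add p q hp hq => rw [map_add, LinearMap.add_apply, hp, hq, Polynomial.eval_add, add_smul]
  | monomial m a =>
    rw [Polynomial.aeval_monomial, Polynomial.eval_monomial, Module.End.mul_apply,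
      Module.algebraMap_end_apply, mul_smul]
    congr 1
    induction m with
    | zero => simp
    | succ m ih => rw [pow_succ', Module.End.mul_apply, ih, LinearMap.map_smul_of_tower, stdOp_H_b,
        smul_smul, pow_succ]

theorem stdRep_Xp_pow_b_of_lt (n : ℤ) {m j : ℕ} (h : j < m) :
    stdRep k n (USl2.gen k Gen.Xp ^ m) (b k j) = 0 := by
  induction m generalizing j with
  | zero => omega
  | succ m ih =>
    rw [pow_succ, map_mul, Module.End.mul_apply, stdRep_gen]
    cases j with
    | zero => rw [stdOp_Xp_b_zero, map_zero]
    | succ j => rw [stdOp_Xp_b_succ, LinearMap.map_smul_of_tower, ih (by omega), smul_zero]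

theorem stdRep_Xp_pow_b_self (n : ℤ) (m : ℕ) :
    stdRep k n (USl2.gen k Gen.Xp ^ m) (b k m) =
      (∏ t ∈ Finset.range m, (((t : k) + 1) * ((n : k) - t))) • b k 0 := by
  induction m with
  | zero => simp
  | succ m ih => rw [pow_succ, map_mul, Module.End.mul_apply, stdRep_gen, stdOp_Xp_b_succ,
      LinearMap.map_smul_of_tower, ih, smul_smul, Finset.prod_range_succ, mul_comm]

/-- `U(𝔰𝔩₂)` acts faithfully on the sum of the Verma modules of integral highest weights. -/
theorem eq_zero_of_stdRep_eq_zero [CharZero k] (u : USl2 k)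
    (h : ∀ n j, (stdRep k n u (b k j)).cf 0 = 0) : u = 0 := by
  obtain ⟨c, rfl⟩ := standardSum_surjective u
  by_contra hne
  have hc : c.support.Nonempty := by
    rw [Finsupp.support_nonempty_iff]
    rintro rfl
    simp at hne
  -- Apply the sum to `b_m` with `m` the least exponent of `X⁺` that occurs. Terms with a larger
  -- exponent kill `b_m`, and those with exponent `m` send it to a multiple of `b_{i'}`, where `i'`
  -- is the exponent of `X⁻`. The coefficient of `b_i` thus isolates `p_{i,m}(n)` up to a factor.
  obtain ⟨⟨i, m⟩, hmem, hmin⟩ := Finset.exists_min_image c.support (fun x => x.2) hc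
  have key : ∀ n : ℤ, (∏ t ∈ Finset.range m, (((t : k) + 1) * ((n : k) - t))) *
      (c (i, m)).eval (n : k) = 0 := by
    intro n
    let ev : USl2 k →ₗ[k] k :=
      { toFun := fun u => (stdRep k n u (b k m)).cf 0 i
        map_add' := fun u v => by simp
        map_smul' := fun a u => by simp }
    -- The last branch is a tautology; exponents below `m` are excluded by minimality.
    have hev : ∀ i' m' p, ev (standardSum k (Finsupp.single (i', m') p)) =
        if m < m' then 0 else if m' = m then (if i' = i then
          (∏ t ∈ Finset.range m, (((t : k) + 1) * ((n : k) - t))) * p.eval (n : k) else 0)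
        else ev (standardSum k (Finsupp.single (i', m') p)) := by
      intro i' m' p
      by_cases h1 : m < m'
      · rw [if_pos h1]
        change (stdRep k n _ (b k m)).cf 0 i = 0
        rw [standardSum_single, map_mul, Module.End.mul_apply, stdRep_Xp_pow_b_of_lt n h1, map_zero]
        rfl
      · rw [if_neg h1]
        by_cases h2 : m' = m
        · subst h2
          rw [if_pos rfl]
          change (stdRep k n _ (b k m')).cf 0 i = _
          rw [standardSum_single, map_mul, Module.End.mul_apply, stdRep_Xp_pow_b_self,
            LinearMap.map_smul_of_tower, map_mul, Module.End.mul_apply, stdRep_aeval_b,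
            LinearMap.map_smul_of_tower, stdRep_Xm_pow_b, smul_smul, zero_add]
          by_cases h3 : i' = i <;> simp [b, HSeries.const_apply, h3]
        · rw [if_neg h2]
    have h0 : ev (standardSum k c) = 0 := by
      change (stdRep k n _ (b k m)).cf 0 i = 0
      rw [h]
      rfl
    rw [← Finsupp.sum_single c, Finsupp.sum, map_sum, map_sum,
      Finset.sum_eq_single_of_mem (i, m) hmem, hev, if_neg (lt_irrefl m), if_pos rfl,
      if_pos rfl] at h0
    · exact h0
    · rintro ⟨i', m'⟩ hx hxne
      have hle := hmin _ hx
      rw [hev]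
      rcases hle.lt_or_eq with h1 | h1
      · exact if_pos h1
      · dsimp only at h1
        rw [if_neg (by omega), if_pos h1.symm, if_neg]
        rintro rfl
        exact hxne (by rw [h1])
  -- The factor `∏ (t+1)(n-t)` is nonzero for every negative `n`, which gives infinitely many roots
  -- of the coefficient polynomial.
  refine Finsupp.mem_support_iff.1 hmem (Polynomial.eq_zero_of_infinite_isRoot _
    (Set.Infinite.mono ?_ (Set.infinite_range_of_injective
      (f := fun t : ℕ => ((-(t : ℤ) - 1 : ℤ) : k)) fun s t hst => ?_)))
  · rintro _ ⟨t, rfl⟩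
    refine (mul_eq_zero.1 (key (-(t : ℤ) - 1))).resolve_left (Finset.prod_ne_zero_iff.2 ?_)
    intro s _
    refine mul_ne_zero (Nat.cast_add_one_ne_zero s) ?_
    have : (((-(t : ℤ) - 1 : ℤ) : k) - s) = ((-(t : ℤ) - 1 - s : ℤ) : k) := by push_cast; ring
    rw [this]
    exact Int.cast_ne_zero.2 (by omega)
  · have := Int.cast_injective (α := k) hst
    omega

variable (k) in
/-- The Verma module of `𝔰𝔩₂` of highest weight `n`, as a representation of `U(𝔰𝔩₂)⟦h⟧`. -/
def stdRepH (n : ℤ) : (USl2 k)⟦X⟧ →ₐ[k⟦X⟧] Module.End k⟦X⟧ (VermaSpace k) :=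
  seriesAction (stdRep k n)

theorem stdRepH_C (n : ℤ) (u : USl2 k) : stdRepH k n (C u) = stdRep k n u := seriesAction_C _ u

theorem vermaRepH_C (ψ : Colouring k) (n : ℤ) (x : Ua k) :
    vermaRepH ψ n (C x) = vermaRep ψ n x := seriesAction_C _ x

/-- Reduction modulo `h` kills the constant term of `u`. As `h` acts injectively, the rest can be
divided by `h` and the argument repeated. -/
theorem eq_zero_of_stdRepH_eq_zero [CharZero k] (u : (USl2 k)⟦X⟧) (h : ∀ n, stdRepH k n u = 0) :
    u = 0 := by
  have key : ∀ (m : ℕ) (u : (USl2 k)⟦X⟧), (∀ n, stdRepH k n u = 0) → coeff m u = 0 := by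
    intro m
    have h0 : ∀ u : (USl2 k)⟦X⟧, (∀ n, stdRepH k n u = 0) → coeff 0 u = 0 := by
      intro u hu
      refine eq_zero_of_stdRep_eq_zero _ fun n j => ?_
      have h1 := congrArg (fun F => (F (b k j)).cf 0) (hu n)
      rw [series_eq_C_add (k := k) u] at h1
      simpa [stdRepH_C, HSeries.X_smul_apply_zero] using h1
    induction m with
    | zero => exact h0
    | succ m ih =>
      intro u hu
      have h2 := ih (mk fun m => coeff (m + 1) u) fun n => by
        have h1 := hu n
        rw [series_eq_C_add (k := k) u, h0 u hu, map_zero, zero_add, map_smul] at h1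
        exact LinearMap.ext fun v => HSeries.X_smul_injective (LinearMap.congr_fun h1 v)
      simpa using h2
  ext m
  exact key m u h

/-! ### Comparison of the two actions -/

theorem exists_vermaRepH_eq_stdRepH [CharZero k] {ψ : Colouring k} (hψ : ψ.IsRegular)
    (u : (USl2 k)⟦X⟧) : ∃ x : (Ua k)⟦X⟧, ∀ n, vermaRepH ψ n x = stdRepH k n u := by
  obtain ⟨z, hz⟩ := exists_lower_classicalFun_eq hψ
  let S : Subalgebra k (USl2 k) :=
    { carrier := {u | ∃ x : (Ua k)⟦X⟧, ∀ n, vermaRepH ψ n x = stdRep k n u}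
      mul_mem' := fun {u v} ⟨x, hx⟩ ⟨y, hy⟩ => ⟨x * y, fun n => by rw [map_mul, map_mul, hx, hy]⟩
      add_mem' := fun {u v} ⟨x, hx⟩ ⟨y, hy⟩ => ⟨x + y, fun n => by rw [map_add, map_add, hx, hy]⟩
      algebraMap_mem' := fun c => ⟨C (algebraMap k _ c), fun n => by
        rw [vermaRepH_C, AlgHom.commutes, AlgHom.commutes]⟩ }
  have hS : ∀ u : USl2 k, ∃ x : (Ua k)⟦X⟧, ∀ n, vermaRepH ψ n x = stdRep k n u := by
    refine USl2.mem_of_gen_mem S fun x => ?_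
    cases x with
    | H => exact ⟨C (Ua.gen k Gen.H), fun n => by rw [vermaRepH_C, vermaRep_gen, stdRep_gen]; rfl⟩
    | Xm => exact ⟨C (Ua.gen k Gen.Xm), fun n => by rw [vermaRepH_C, vermaRep_gen, stdRep_gen]; rfl⟩
    | Xp =>
      refine ⟨C (Ua.gen k Gen.Xp) + (X : k⟦X⟧) • z, fun n => ?_⟩
      rw [map_add, map_smul, vermaRepH_C, vermaRep_gen, stdRep_gen]
      exact (hz n).symm
  choose x hx using hS
  -- The coefficients of `u` lift to series `x (coeff i u)`, which are summed with weights `h^i`;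
  -- the operators `w i` are the actions of the tails of `u`.
  obtain ⟨U, hU⟩ := exists_seriesAction_eq (vermaRep ψ) (fun i => x (coeff i u))
    (fun i n => stdRepH k n (mk fun m => coeff (i + m) u)) (fun i n => by
      have h := hx (coeff i u) n
      rw [vermaRepH] at h
      rw [h, series_eq_C_add (k := k) (mk fun m => coeff (i + m) u), map_add, map_smul, stdRepH_C]
      simp only [coeff_mk, add_zero, add_assoc, add_comm 1])
  refine ⟨U, fun n => (hU n).trans ?_⟩
  simp only [zero_add]
  congr 1
  ext m
  simp

/-- The remainder is `h` times the action of an element, not merely an operator divisible by `h`.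
This is what the converse inclusion of images and the compatibility modulo `h` both require. -/
theorem exists_stdRepH_add [CharZero k] {ψ : Colouring k} (hψ : ψ.IsRegular) (x : Ua k) :
    ∃ y : (Ua k)⟦X⟧, ∀ n, vermaRep ψ n x =
      stdRep k n (UaToUSl2 k x) + (X : k⟦X⟧) • vermaRepH ψ n y := by
  obtain ⟨x, rfl⟩ := RingQuot.mkAlgHom_surjective k (UaRel k) x
  induction x using FreeAlgebra.induction with
  | grade0 c =>
    refine ⟨0, fun n => ?_⟩
    simp only [AlgHom.commutes, map_zero, smul_zero, add_zero]
  | grade1 g =>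
    change ∃ y : (Ua k)⟦X⟧, ∀ n, vermaRep ψ n (Ua.gen k g) =
      stdRep k n (UaToUSl2 k (Ua.gen k g)) + (X : k⟦X⟧) • vermaRepH ψ n y
    have hg : UaToUSl2 k (Ua.gen k g) = USl2.gen k g := Ua.lift_gen _ _ _ _ g
    simp only [hg, vermaRep_gen, stdRep_gen]
    cases g with
    | H => exact ⟨0, fun n => by simp only [map_zero, smul_zero, add_zero]; rfl⟩
    | Xm => exact ⟨0, fun n => by simp only [map_zero, smul_zero, add_zero]; rfl⟩
    | Xp =>
      obtain ⟨z, hz⟩ := exists_lower_classicalFun_eq hψ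
      refine ⟨-z, fun n => ?_⟩
      rw [map_neg, smul_neg, ← sub_eq_add_neg, eq_sub_iff_add_eq]
      exact (hz n).symm
  | mul p q hp hq =>
    obtain ⟨y, hy⟩ := hp
    obtain ⟨z, hz⟩ := hq
    obtain ⟨w, hw⟩ := exists_vermaRepH_eq_stdRepH hψ
      (C (UaToUSl2 k (RingQuot.mkAlgHom k (UaRel k) p)))
    -- With `p = p₀ + h y` and `q = q₀ + h z` as operators, `p q = p₀ q₀ + h (p₀ z + y q)`. The
    -- previous theorem supplies `w` acting as `p₀`.
    refine ⟨w * z + y * C (RingQuot.mkAlgHom k (UaRel k) q), fun n => ?_⟩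
    simp only [map_mul, map_add, hw, stdRepH_C, vermaRepH_C]
    conv_lhs => rw [hy, add_mul]
    conv_lhs => enter [1]; rw [hz]
    rw [mul_add, smul_add, smul_mul_assoc, mul_smul_comm, add_assoc]
  | add p q hp hq =>
    obtain ⟨y, hy⟩ := hp
    obtain ⟨z, hz⟩ := hq
    refine ⟨y + z, fun n => ?_⟩
    simp only [map_add, hy, hz, smul_add]
    abel

/-- Replacing the constant term of `x` by its image in `U(𝔰𝔩₂)` costs an error `h y` of the same
kind, so the replacement can be iterated. -/
theorem exists_stdRepH_eq_vermaRepH [CharZero k] {ψ : Colouring k} (hψ : ψ.IsRegular)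
    (x : (Ua k)⟦X⟧) : ∃ u : (USl2 k)⟦X⟧, ∀ n, stdRepH k n u = vermaRepH ψ n x := by
  have step : ∀ x : (Ua k)⟦X⟧, ∃ y : (Ua k)⟦X⟧, ∀ n, vermaRepH ψ n x =
      stdRepH k n (C (UaToUSl2 k (coeff 0 x))) + (X : k⟦X⟧) • vermaRepH ψ n y := by
    intro x
    obtain ⟨y, hy⟩ := exists_stdRepH_add hψ (coeff 0 x)
    refine ⟨y + mk fun m => coeff (m + 1) x, fun n => ?_⟩
    conv_lhs => rw [series_eq_C_add (k := k) x, map_add, map_smul, vermaRepH_C, hy]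
    rw [stdRepH_C, map_add, smul_add, add_assoc]
  choose next hnext using step
  exact exists_seriesAction_eq (stdRep k) (fun i => C (UaToUSl2 k (coeff 0 (next^[i] x))))
    (fun i n => vermaRepH ψ n (next^[i] x)) fun i n => by
      rw [Function.iterate_succ_apply']
      exact hnext _ n

/-! ### The trivialization -/

/-- The joint action of `U_h(ψ)` on all the deformed Verma modules. -/
def uhAct (ψ : Colouring k) : Uh ψ →ₐ[k⟦X⟧] (ℤ → Module.End k⟦X⟧ (VermaSpace k)) :=
  Ideal.Quotient.liftₐ (vermaIdeal ψ) (AlgHom.pi fun n => vermaRepH ψ n) fun _ hx =>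
    funext fun n => LinearMap.ext fun v => hx n v

theorem uhAct_proj (ψ : Colouring k) (x : (Ua k)⟦X⟧) (n : ℤ) :
    uhAct ψ (Uh.proj ψ x) n = vermaRepH ψ n x := rfl

theorem uhAct_gen (ψ : Colouring k) (x : Gen) (n : ℤ) : uhAct ψ (Uh.gen ψ x) n = vermaOp ψ n x := by
  rw [Uh.gen, uhAct_proj, vermaRepH_C, vermaRep_gen]

theorem uhProj_surjective (ψ : Colouring k) : Function.Surjective (Uh.proj ψ) :=
  Ideal.Quotient.mk_surjective

theorem uhAct_injective (ψ : Colouring k) : Function.Injective (uhAct ψ) := by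
  rw [injective_iff_map_eq_zero]
  intro y hy
  obtain ⟨x, rfl⟩ := uhProj_surjective ψ y
  refine Ideal.Quotient.eq_zero_iff_mem.2 fun n v => ?_
  rw [← uhAct_proj, hy]
  rfl

variable (k) in
/-- The joint action of `U(𝔰𝔩₂)⟦h⟧` on the Verma modules of integral highest weights. -/
def stdAct : (USl2 k)⟦X⟧ →ₐ[k⟦X⟧] (ℤ → Module.End k⟦X⟧ (VermaSpace k)) :=
  AlgHom.pi fun n => stdRepH k n

theorem stdAct_apply (u : (USl2 k)⟦X⟧) (n : ℤ) : stdAct k u n = stdRepH k n u := rfl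

theorem stdAct_injective [CharZero k] : Function.Injective (stdAct k) := by
  rw [injective_iff_map_eq_zero]
  exact fun u hu => eq_zero_of_stdRepH_eq_zero u fun n => congrFun hu n

theorem range_stdAct [CharZero k] {ψ : Colouring k} (hψ : ψ.IsRegular) :
    (stdAct k).range = (uhAct ψ).range := by
  apply le_antisymm
  · rintro _ ⟨u, rfl⟩
    obtain ⟨x, hx⟩ := exists_vermaRepH_eq_stdRepH hψ u
    exact ⟨Uh.proj ψ x, funext hx⟩
  · rintro _ ⟨y, rfl⟩
    obtain ⟨x, rfl⟩ := uhProj_surjective ψ y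
    obtain ⟨u, hu⟩ := exists_stdRepH_eq_vermaRepH hψ x
    exact ⟨u, funext hu⟩

/-- The isomorphism `U(𝔰𝔩₂)⟦h⟧ ≃ U_h(ψ)` that is compatible with the actions on Verma modules. -/
def trivialization [CharZero k] {ψ : Colouring k} (hψ : ψ.IsRegular) :
    (USl2 k)⟦X⟧ ≃ₐ[k⟦X⟧] Uh ψ :=
  (AlgEquiv.ofInjective (stdAct k) stdAct_injective).trans
    ((Subalgebra.equivOfEq _ _ (range_stdAct hψ)).trans
      (AlgEquiv.ofInjective (uhAct ψ) (uhAct_injective ψ)).symm)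

theorem uhAct_trivialization [CharZero k] {ψ : Colouring k} (hψ : ψ.IsRegular) (u : (USl2 k)⟦X⟧) :
    uhAct ψ (trivialization hψ u) = stdAct k u := by
  have h : AlgEquiv.ofInjective (uhAct ψ) (uhAct_injective ψ) (trivialization hψ u) =
      Subalgebra.equivOfEq _ _ (range_stdAct hψ)
        (AlgEquiv.ofInjective (stdAct k) stdAct_injective u) := by
    simp [trivialization]
  exact congrArg Subtype.val h

theorem hzeroMap_bijective {A : Type v} {B : Type w} [Ring A] [Algebra k⟦X⟧ A] [Ring B]
    [Algebra k⟦X⟧ B] (g : A ≃ₐ[k⟦X⟧] B) :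
    Function.Bijective (hzeroMap (g : A →ₐ[k⟦X⟧] B)) := by
  have hmk : ∀ a, hzeroMap (g : A →ₐ[k⟦X⟧] B) (Ideal.Quotient.mk _ a) =
      Ideal.Quotient.mk (hIdeal k B) (g a) := fun _ => rfl
  constructor
  · rw [injective_iff_map_eq_zero]
    intro y hy
    obtain ⟨a, rfl⟩ := Ideal.Quotient.mk_surjective y
    rw [hmk, Ideal.Quotient.eq_zero_iff_mem] at hy
    obtain ⟨c, hc⟩ := hy
    refine Ideal.Quotient.eq_zero_iff_mem.2 ⟨g.symm c, g.injective ?_⟩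
    rw [hc, map_smul, AlgEquiv.apply_symm_apply]
  · intro y
    obtain ⟨c, rfl⟩ := Ideal.Quotient.mk_surjective y
    exact ⟨Ideal.Quotient.mk _ (g.symm c), by rw [hmk, AlgEquiv.apply_symm_apply]⟩

theorem isBTrivialization_trivialization [CharZero k] {ψ : Colouring k} (hψ : ψ.IsRegular) :
    IsBTrivialization ψ (trivialization hψ) where
  map_H := uhAct_injective ψ (funext fun n => by
    rw [uhAct_trivialization, stdAct_apply, stdRepH_C, stdRep_gen, uhAct_gen]; rfl)
  map_Xm := uhAct_injective ψ (funext fun n => by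
    rw [uhAct_trivialization, stdAct_apply, stdRepH_C, stdRep_gen, uhAct_gen]; rfl)
  hzero_bijective := hzeroMap_bijective _
  hzero_str x := by
    obtain ⟨y, hy⟩ := exists_stdRepH_add hψ x
    have hC : seriesMap (UaToUSl2 k) (C x) = C (UaToUSl2 k x) := PowerSeries.map_C _ _
    change Ideal.Quotient.mk (hIdeal k (Uh ψ)) (trivialization hψ (seriesMap (UaToUSl2 k) (C x))) =
      Ideal.Quotient.mk (hIdeal k (Uh ψ)) (Uh.proj ψ (C x))
    rw [hC]
    -- The element `x` acts as its image in `U(𝔰𝔩₂)` plus `h y`, so the difference of the two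
    -- classes is `-h y`; faithfulness turns this into an identity in `U_h(ψ)`.
    refine Ideal.Quotient.eq.2 ⟨-Uh.proj ψ y, uhAct_injective ψ (funext fun n => ?_)⟩
    rw [map_sub, uhAct_trivialization, smul_neg, map_neg, map_smul]
    change stdAct k (C (UaToUSl2 k x)) n - uhAct ψ (Uh.proj ψ (C x)) n =
      -((X : k⟦X⟧) • uhAct ψ (Uh.proj ψ y) n)
    rw [stdAct_apply, uhAct_proj, uhAct_proj, stdRepH_C, vermaRepH_C, hy]
    abel

/-! ### Uniqueness -/

/-- A vector of a Verma module whose weight is the highest weight plus two is zero. -/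
theorem eq_zero_of_weight [CharZero k] (n : ℤ) (v : VermaSpace k)
    (h : stdOp k n Gen.H v = ((n : k) + 2) • v) : v = 0 := by
  let T : (ℕ →₀ k) →ₗ[k] ℕ →₀ k :=
    Finsupp.lsum k fun j => ((n : k) - 2 * j) • Finsupp.lsingle j
  have hT : ∀ f : ℕ →₀ k, ∀ j, T f j = ((n : k) - 2 * j) * f j := by
    intro f j
    induction f using Finsupp.induction_linear with
    | zero => simp
    | add f g hf hg => rw [map_add, Finsupp.add_apply, hf, hg, Finsupp.add_apply, mul_add]
    | single i c =>
      by_cases hij : i = j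
      · subst hij
        simp [T]
      · simp [T, hij]
  have hH : ∀ v : VermaSpace k, stdOp k n Gen.H v = ⟨fun m => T (v.cf m)⟩ := by
    have hlin : stdOp k n Gen.H = HSeries.extend ((HSeries.const (k := k)).comp T) := by
      apply op_ext
      intro j
      rw [stdOp_H_b, b, HSeries.extend_const, ← map_smul]
      simp [T]
    intro v
    rw [hlin]
    ext1 m
    rw [HSeries.extend_apply, Finset.sum_eq_single (m, 0)]
    · simp [HSeries.const_apply]
    · rintro ⟨i, j⟩ hp hne
      have hj : j ≠ 0 := by
        rintro rfl
        apply hne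
        simp at hp
        simp [hp]
      simp [HSeries.const_apply, hj]
    · simp
  rw [hH] at h
  ext m j
  have h1 := congrArg (fun w => w.cf m j) h
  simp only [hT, HSeries.base_smul_apply, Finsupp.smul_apply, smul_eq_mul] at h1
  have h2 : (2 * ((j : k) + 1)) * (v.cf m) j = 0 := by linear_combination -h1
  have h3 : (2 * ((j : k) + 1)) ≠ 0 := mul_ne_zero two_ne_zero (Nat.cast_add_one_ne_zero j)
  simpa using (mul_eq_zero.1 h2).resolve_left h3

/-- The operator of `X⁺` is determined by those of `H` and `X⁻`. -/
theorem eq_stdOp_Xp [CharZero k] (n : ℤ) (T : Module.End k⟦X⟧ (VermaSpace k))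
    (h1 : stdOp k n Gen.H * T - T * stdOp k n Gen.H = (2 : k) • T)
    (h2 : T * stdOp k n Gen.Xm - stdOp k n Gen.Xm * T = stdOp k n Gen.H) :
    T = stdOp k n Gen.Xp := by
  apply op_ext
  intro j
  induction j with
  | zero =>
    rw [stdOp_Xp_b_zero]
    -- The first relation gives `T b_0` the weight `n + 2`. In the successor case the second
    -- relation gives `T b_{j+1} = X⁻ T b_j + H b_j`.
    apply eq_zero_of_weight n
    have h := LinearMap.congr_fun h1 (b k 0)
    rw [LinearMap.sub_apply, Module.End.mul_apply, Module.End.mul_apply, stdOp_H_b,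
      LinearMap.map_smul_of_tower, LinearMap.smul_apply, sub_eq_iff_eq_add] at h
    rw [h, ← add_smul]
    congr 1
    push_cast
    ring
  | succ j ih =>
    have h := LinearMap.congr_fun h2 (b k j)
    rw [LinearMap.sub_apply, Module.End.mul_apply, Module.End.mul_apply, stdOp_Xm_b, stdOp_H_b,
      sub_eq_iff_eq_add, ih] at h
    rw [h, stdOp_Xp_b_succ]
    cases j with
    | zero =>
      rw [stdOp_Xp_b_zero, map_zero, add_zero]
      congr 1
      push_cast
      ring
    | succ j =>
      rw [stdOp_Xp_b_succ, LinearMap.map_smul_of_tower, stdOp_Xm_b, ← add_smul]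
      congr 1
      push_cast
      ring

/-- Through `g`, each deformed Verma module becomes a `U(𝔰𝔩₂)`-module on which `H` and `X⁻` act in
the standard way, hence so does `X⁺`. Thus `g` is determined by the faithful action of `U_h(ψ)`. -/
theorem IsBTrivialization.uhAct_apply [CharZero k] {ψ : Colouring k}
    {g : (USl2 k)⟦X⟧ ≃ₐ[k⟦X⟧] Uh ψ} (hg : IsBTrivialization ψ g) (u : (USl2 k)⟦X⟧) :
    uhAct ψ (g u) = stdAct k u := by
  funext n
  let G : (USl2 k)⟦X⟧ →ₐ[k⟦X⟧] Module.End k⟦X⟧ (VermaSpace k) :=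
    (Pi.evalAlgHom k⟦X⟧ _ n).comp ((uhAct ψ).comp (g : (USl2 k)⟦X⟧ →ₐ[k⟦X⟧] Uh ψ))
  let G₀ : USl2 k →ₐ[k] Module.End k⟦X⟧ (VermaSpace k) :=
    { (G : (USl2 k)⟦X⟧ →+* Module.End k⟦X⟧ (VermaSpace k)).comp PowerSeries.C with
      commutes' := fun c => by
        have h : (PowerSeries.C (algebraMap k (USl2 k) c) : (USl2 k)⟦X⟧) =
            algebraMap k⟦X⟧ _ (algebraMap k k⟦X⟧ c) := (PowerSeries.map_C _ c).symm
        change G (PowerSeries.C (algebraMap k (USl2 k) c)) = _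
        rw [h, AlgHom.commutes, ← IsScalarTower.algebraMap_apply] }
  have hG₀ : ∀ a, G₀ a = uhAct ψ (g (C a)) n := fun _ => rfl
  have hH : G₀ (USl2.gen k Gen.H) = stdOp k n Gen.H := by
    rw [hG₀, hg.map_H, uhAct_gen]; rfl
  have hXm : G₀ (USl2.gen k Gen.Xm) = stdOp k n Gen.Xm := by
    rw [hG₀, hg.map_Xm, uhAct_gen]; rfl
  have hXp : G₀ (USl2.gen k Gen.Xp) = stdOp k n Gen.Xp := by
    apply eq_stdOp_Xp
    · rw [← hH, ← map_mul, ← map_mul, ← map_sub, USl2.rel_of_lie k _ _ _ (sl2Gen_lie_H_Xp k),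
        map_smul]
    · rw [← hH, ← hXm, ← map_mul, ← map_mul, ← map_sub, USl2.gen_Xp_mul_Xm, add_sub_cancel_left]
  have hstd : G₀ = stdRep k n := USl2.algHom_ext fun x => by
    rw [stdRep_gen]
    cases x with
    | H => exact hH
    | Xm => exact hXm
    | Xp => exact hXp
  refine LinearMap.ext fun v => ?_
  -- A `k⟦h⟧`-linear map into a module `V⟦h⟧` is automatically `h`-adically continuous, so agreement
  -- on constants suffices. This is applied one vector `v` at a time, to have values in such a
  -- module.
  have h : (LinearMap.applyₗ v).comp G.toLinearMap =
      (LinearMap.applyₗ v).comp (stdRepH k n).toLinearMap := by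
    apply series_hom_ext
    intro a
    change G₀ a v = stdRepH k n (C a) v
    rw [stdRepH_C, hstd]
  exact LinearMap.congr_fun h u

end ColouredKM

end

/-! ### Existence and uniqueness of the trivialization -/

theorem mainTheorem4 {k : Type*} [Field k] [CharZero k] (ψ : ColouredKM.Colouring k)
    (hψ : ψ.IsRegular) :
    ∃! g : PowerSeries (ColouredKM.USl2 k) ≃ₐ[PowerSeries k] ColouredKM.Uh ψ,
      ColouredKM.IsBTrivialization ψ g :=
  ⟨ColouredKM.trivialization hψ, ColouredKM.isBTrivialization_trivialization hψ, fun _ hg =>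
    AlgEquiv.ext fun u => ColouredKM.uhAct_injective ψ
      ((hg.uhAct_apply u).trans (ColouredKM.uhAct_trivialization hψ u).symm)⟩
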